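/- Let $-1/2<s<0$ and put $\beta:=1+1/s<0$. Let $\mathcal G$ be the class of all convex lower semicontinuous functions $g:\mathbb R\to[0,\infty]$ whose effective domain $\{g<\infty\}$ has non-empty interior and which satisfy $g(x)\to\infty$ as $|x|\to\infty$. For a probability measure $Q$ on $\mathbb R$ and $g\in\mathcal G$ let $$L_s(g,Q):=\int g\,dQ+\frac1{|\beta|}\int_{\mathbb R} g(x)^{\beta}\,dx\in[0,\infty]$$ (with $0^{\beta}=\infty$, $\infty^{\beta}=0$, and likewise for the exponent $1/s$). Let $Q$ be a probability measure on $\mathbb R$ with $\int|x|\,dQ<\infty$ whose convex support (the intersection of all closed convex sets $C$ with $Q(C)=1$) has non-empty interior, and let $G$ be the distribution function of $Q$. Write $g=g_s(\cdot|Q)$ if $g\in\mathcal G$ minimizes $L_s(\cdot,Q)$ over $\mathcal G$. Let $g\in\mathcal G$ be such that $f:=g^{1/s}$ is a probability density on $\mathbb R$, with distribution function $F$. Then $F-G$ is Lebesgue integrable on $\mathbb R$, and $g=g_s(\cdot|Q)$ if and only if both of the following hold: 1. $\int_{\mathbb R}(F-G)(t)\,dt=0$; 2. $\int_{-\infty}^x(F-G)(t)\,dt\le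 0$ for all $x\in\mathbb R$, with equality whenever $x\in\tilde{\mathcal S}(g)$, where $$\tilde{\mathcal S}(g):=\Big\{x\in\mathbb R:\ g(x)<\tfrac12\big(g(x+\delta)+g(x-\delta)\big)\text{ for all sufficiently small }\delta>0\Big\}.$$ -/

import Mathlib

open MeasureTheory ProbabilityTheory Filter Topology Set
open scoped ENNReal NNReal

noncomputable section

/-- The class `𝒢` in dimension one: the closed convex functions `g : ℝ → [0, ∞]` whose effective
domain `{g < ∞}` has non-empty interior and which are coercive, i.e. `g x → ∞` as `|x| → ∞`.
Convexity is `g (a x + b y) ≤ a g x + b g y` for all nonnegative `a`, `b` with `a + b = 1`;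
closed means lower semicontinuous. -/
structure IsCoerciveClosedConvex (g : ℝ → ℝ≥0∞) : Prop where
  convex : ConvexOn ℝ≥0 univ g
  closed : LowerSemicontinuous g
  interior_dom_nonempty : (interior {x | g x < ∞}).Nonempty
  coercive : Tendsto g (cocompact ℝ) (𝓝 ∞)

/-- The functional `L_s(g, Q) = ∫ g dQ + (1 / |β|) ∫ g ^ β dx`, `β = 1 + 1 / s`, with values
in `[0, ∞]`. For `β < 0` one has `0 ^ β = ∞` and `∞ ^ β = 0`. -/
def renyiFunctional (s : ℝ) (Q : Measure ℝ) (g : ℝ → ℝ≥0∞) : ℝ≥0∞ :=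
  ∫⁻ x, g x ∂Q + ENNReal.ofReal (1 / |1 + 1 / s|) * ∫⁻ x, g x ^ (1 + 1 / s)

/-- `g = g_s(· | Q)`: the function `g` solves the problem of minimizing `L_s(·, Q)` over `𝒢`. -/
def IsRenyiProjection (s : ℝ) (Q : Measure ℝ) (g : ℝ → ℝ≥0∞) : Prop :=
  IsCoerciveClosedConvex g ∧
    ∀ h : ℝ → ℝ≥0∞, IsCoerciveClosedConvex h → renyiFunctional s Q g ≤ renyiFunctional s Q h

/-- The convex support of a measure on the line: the intersection of all closed convex sets of
mass one. -/
def csupp (Q : Measure ℝ) : Set ℝ :=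
  ⋂₀ {C : Set ℝ | IsClosed C ∧ Convex ℝ C ∧ Q C = 1}

/-- The points `x` at which `g x < (g (x + δ) + g (x - δ)) / 2` for all sufficiently small
`δ > 0`. -/
def strictConvexityPoints (g : ℝ → ℝ≥0∞) : Set ℝ :=
  {x | ∀ᶠ δ in 𝓝[>] (0 : ℝ), g x < (g (x + δ) + g (x - δ)) / 2}

/-- The measure with Lebesgue density `f = g ^ (1 / s)`. For `s < 0` the density is `0` where
`g = ∞`. -/
def powerMeasure (s : ℝ) (g : ℝ → ℝ≥0∞) : Measure ℝ :=
  volume.withDensity fun x => g x ^ (1 / s)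

end

/-! Write P for the probability measure with density `g ^ (1 / s)`. By Tonelli the integral of F
over (-∞, x] is the lower partial moment ∫ (x - y)⁺ dP(y), so the two conditions say that P and Q
have the same mean, that the lower moments of P are at most those of Q (P precedes Q in convex
order), and that they agree at the points of strict convexity of g. The derivative of y ↦ y^β / |β|
is -y^(1/s), so the derivative of the functional at g in a direction v is ∫ v dQ - ∫ v dP; the
theorem is the first-order condition of a convex problem over the cone of convex functions.

The link between moments and convex functions is Taylor's formula: a convex g is affine plus an
integral of kinks against its second derivative measure μ
(`IsCoerciveClosedConvex.exists_isCurvature`). Integrating against P and Q shows that, for equal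
means, ∫ g dP ≤ ∫ g dQ as soon as the lower moments are ordered μ-almost everywhere
(`IsCurvature.lintegral_le`), and μ lives on the strict convexity points
(`IsCurvature.ae_mem_strictConvexityPoints`).

Sufficiency: for a competitor h, convex order gives ∫ h dP ≤ ∫ h dQ, while equality of moments on
the strict convexity points gives ∫ g dQ ≤ ∫ g dP. The tangent inequality `rpow_tangent` at g closes
the chain.

Necessity: adding ε(t - ·)⁺ to g orders the moments, and adding ±εx equates the means. Removing a
small fraction of μ on an interval keeps g convex and gives the reverse inequality for moments
integrated against μ there; shrinking the interval around a strict convexity point forces equality.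

Since s > -1/2 means 1/s < -2, linear growth of g makes |x| g^(1/s) integrable; this gives P a mean
and a dominating function as ε → 0. All integrals are kept in `ℝ≥0∞`, with linear terms split into
positive and negative parts on opposite sides of equations. -/

/-- The second-order kernel at base point `c`: the convex function of `y` with a kink of unit
size at `t` that vanishes at `c`. -/
noncomputable def kink (c y t : ℝ) : ℝ≥0∞ :=
  if c < t then ENNReal.ofReal (y - t) else ENNReal.ofReal (t - y)

lemma measurable_kink (c : ℝ) : Measurable fun z : ℝ × ℝ => kink c z.1 z.2 := by
  unfold kink
  refine Measurable.ite (measurableSet_lt measurable_const measurable_snd) ?_ ?_ <;> fun_prop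

lemma measurable_kink_right (c y : ℝ) : Measurable fun t => kink c y t :=
  (measurable_kink c).comp measurable_prodMk_left

lemma kink_self (c t : ℝ) : kink c c t = 0 := by
  unfold kink
  split_ifs with h
  · exact ENNReal.ofReal_of_nonpos (by linarith)
  · exact ENNReal.ofReal_of_nonpos (by linarith)

lemma kink_eq_zero_of_le_of_le {c y t : ℝ} (h : c < y) (ht : t ≤ c) : kink c y t = 0 := by
  rw [kink, if_neg (not_lt.2 ht)]
  exact ENNReal.ofReal_of_nonpos (by linarith)

lemma kink_eq_zero_of_lt_of_lt {c y t : ℝ} (h : y < c) (ht : c < t) : kink c y t = 0 := by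
  rw [kink, if_pos ht]
  exact ENNReal.ofReal_of_nonpos (by linarith)

/-! ### Second derivative measure of a real convex function on an open interval. -/

section Curvature

variable {I : Set ℝ} {φ : ℝ → ℝ}

lemma ConvexOn.monotoneOn_rightDeriv_of_isOpen (hI : IsOpen I) (hφ : ConvexOn ℝ I φ) :
    MonotoneOn (fun u => derivWithin φ (Ioi u) u) I := by
  simpa [hI.interior_eq] using hφ.monotoneOn_rightDeriv

lemma ConvexOn.intervalIntegral_rightDeriv (hI : IsOpen I) (hφ : ConvexOn ℝ I φ) {a b : ℝ}
    (ha : a ∈ I) (hb : b ∈ I) (hab : a ≤ b) :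
    IntervalIntegrable (fun u => derivWithin φ (Ioi u) u) volume a b ∧
      ∫ u in a..b, derivWithin φ (Ioi u) u = φ b - φ a := by
  have hsub : Icc a b ⊆ I := hφ.1.ordConnected.out ha hb
  have hint : IntervalIntegrable (fun u => derivWithin φ (Ioi u) u) volume a b := by
    refine MonotoneOn.intervalIntegrable ?_
    rw [uIcc_of_le hab]
    exact (hφ.monotoneOn_rightDeriv_of_isOpen hI).mono hsub
  refine ⟨hint, intervalIntegral.integral_eq_sub_of_hasDeriv_right_of_le hab
    ((hφ.continuousOn hI).mono hsub) (fun x hx => ?_) hint⟩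
  exact hφ.hasDerivWithinAt_rightDeriv_of_mem_interior
    (by rw [hI.interior_eq]; exact hsub (Ioo_subset_Icc_self hx))

/-- Right continuity of the right derivative of a convex function. -/
lemma ConvexOn.le_rightDeriv_of_forall_lt (hI : IsOpen I) (hφ : ConvexOn ℝ I φ) {c l : ℝ}
    (hc : c ∈ I) (h : ∀ u ∈ I, c < u → l ≤ derivWithin φ (Ioi u) u) :
    l ≤ derivWithin φ (Ioi c) c := by
  have hcont := hφ.continuousOn hI
  have key : ∀ y ∈ I, c < y → l ≤ slope φ c y := by
    intro y hy hcy
    have h1 : Tendsto (fun u => slope φ u y) (𝓝[>] c) (𝓝 (slope φ c y)) := by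
      have : ContinuousAt (fun u => (y - u)⁻¹ * (φ y - φ u)) c := by
        have hφc : ContinuousAt φ c := hcont.continuousAt (hI.mem_nhds hc)
        have : y - c ≠ 0 := by linarith
        fun_prop (disch := assumption)
      exact (this.tendsto.mono_left nhdsWithin_le_nhds)
    refine ge_of_tendsto h1 ?_
    filter_upwards [Ioo_mem_nhdsGT hcy] with u hu
    have huI : u ∈ I := hφ.1.ordConnected.out hc hy (Ioo_subset_Icc_self hu)
    exact (h u huI hu.1).trans (hφ.rightDeriv_le_slope_of_mem_interior
      (by rwa [hI.interior_eq]) hy hu.2)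
  have hd := hφ.hasDerivWithinAt_rightDeriv_of_mem_interior (x := c) (by rwa [hI.interior_eq])
  rw [hasDerivWithinAt_iff_tendsto_slope' (by simp)] at hd
  refine ge_of_tendsto hd ?_
  filter_upwards [self_mem_nhdsWithin, mem_nhdsWithin_of_mem_nhds (hI.mem_nhds hc)] with y hy hyI
  exact key y hyI hy

/-- Tonelli for the region between the level p and the graph of d: it trades the integral over
positions u for one over slopes l. -/
lemma lintegral_ofReal_sub_eq {d : ℝ → ℝ} (hd : Measurable d) (p : ℝ) (A : Set ℝ)
    (hA : MeasurableSet A) :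
    ∫⁻ u in A, ENNReal.ofReal (d u - p) = ∫⁻ l, volume {u | u ∈ A ∧ p ≤ l ∧ l < d u} := by
  have hS : MeasurableSet {z : ℝ × ℝ | z.1 ∈ A ∧ p ≤ z.2 ∧ z.2 < d z.1} :=
    (measurable_fst hA).inter ((measurableSet_le measurable_const measurable_snd).inter
      (measurableSet_lt measurable_snd (hd.comp measurable_fst)))
  have h := Measure.prod_apply (μ := (volume : Measure ℝ)) (ν := (volume : Measure ℝ)) hS
  rw [Measure.prod_apply_symm hS] at h
  rw [← lintegral_indicator hA]
  refine Eq.trans (lintegral_congr fun u => ?_) h.symm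
  by_cases hu : u ∈ A
  · have : Prod.mk u ⁻¹' {z : ℝ × ℝ | z.1 ∈ A ∧ p ≤ z.2 ∧ z.2 < d z.1} = Ico p (d u) := by
      ext l; simp [hu]
    rw [this, Real.volume_Ico, indicator_of_mem hu]
  · have : Prod.mk u ⁻¹' {z : ℝ × ℝ | z.1 ∈ A ∧ p ≤ z.2 ∧ z.2 < d z.1} = ∅ := by
      ext l; simp [hu]
    rw [this, measure_empty, indicator_of_notMem hu]

lemma lintegral_ofReal_sub_eq' {d : ℝ → ℝ} (hd : Measurable d) (p : ℝ) (A : Set ℝ)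
    (hA : MeasurableSet A) :
    ∫⁻ u in A, ENNReal.ofReal (p - d u) = ∫⁻ l, volume {u | u ∈ A ∧ d u ≤ l ∧ l < p} := by
  have hS : MeasurableSet {z : ℝ × ℝ | z.1 ∈ A ∧ d z.1 ≤ z.2 ∧ z.2 < p} :=
    (measurable_fst hA).inter ((measurableSet_le (hd.comp measurable_fst) measurable_snd).inter
      (measurableSet_lt measurable_snd measurable_const))
  have h := Measure.prod_apply (μ := (volume : Measure ℝ)) (ν := (volume : Measure ℝ)) hS
  rw [Measure.prod_apply_symm hS] at h
  rw [← lintegral_indicator hA]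
  refine Eq.trans (lintegral_congr fun u => ?_) h.symm
  by_cases hu : u ∈ A
  · have : Prod.mk u ⁻¹' {z : ℝ × ℝ | z.1 ∈ A ∧ d z.1 ≤ z.2 ∧ z.2 < p} = Ico (d u) p := by
      ext l; simp [hu]
    rw [this, Real.volume_Ico, indicator_of_mem hu]
  · have : Prod.mk u ⁻¹' {z : ℝ × ℝ | z.1 ∈ A ∧ d z.1 ≤ z.2 ∧ z.2 < p} = ∅ := by
      ext l; simp [hu]
    rw [this, measure_empty, indicator_of_notMem hu]

/-- Taylor's formula with integral remainder for a convex function on an open interval: the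
remainder is an integral of kinks with respect to the second derivative measure. -/
theorem ConvexOn.exists_curvature (hI : IsOpen I) (hφ : ConvexOn ℝ I φ) :
    ∃ μ : Measure ℝ, SFinite μ ∧ μ Iᶜ = 0 ∧ ∀ c ∈ I, ∃ p : ℝ, ∀ y ∈ I,
      φ c + p * (y - c) ≤ φ y ∧
        ENNReal.ofReal (φ y - φ c - p * (y - c)) = ∫⁻ t, kink c y t ∂μ := by
  set d : ℝ → ℝ := fun u => derivWithin φ (Ioi u) u with hd
  have hdm : Measurable d := measurable_derivWithin_Ioi φ
  have hmono : MonotoneOn d I := hφ.monotoneOn_rightDeriv_of_isOpen hI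
  -- The measure is the image of Lebesgue measure on slopes under the generalized inverse τ of the
  -- right derivative. J keeps only slopes attained or crossed inside I, so that the infimum
  -- defining τ is a point of I.
  set J : Set ℝ := {l | (∃ u ∈ I, d u ≤ l) ∧ ∃ u ∈ I, l < d u} with hJ
  have hJm : MeasurableSet J := by
    refine OrdConnected.measurableSet ⟨?_⟩
    rintro x ⟨⟨u, hu, hux⟩, -⟩ y ⟨-, v, hv, hvy⟩ z hz
    exact ⟨⟨u, hu, hux.trans hz.1⟩, v, hv, hz.2.trans_lt hvy⟩
  set τ : ℝ → ℝ := fun l => sInf {u | u ∈ I ∧ l < d u} with hτ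
  have hlow : ∀ l, ∀ u ∈ I, d u ≤ l → ∀ v ∈ {u | u ∈ I ∧ l < d u}, u ≤ v := by
    rintro l u hu hul v ⟨hv, hlv⟩
    by_contra! hvu
    exact absurd (hmono hv hu hvu.le) (by linarith)
  have hbdd : ∀ l ∈ J, BddBelow {u | u ∈ I ∧ l < d u} := by
    rintro l ⟨⟨u, hu, hul⟩, -⟩
    exact ⟨u, fun v hv => hlow l u hu hul v hv⟩
  have hle : ∀ l ∈ J, ∀ u ∈ I, d u ≤ l → u ≤ τ l := by
    rintro l ⟨-, w, hw, hlw⟩ u hu hul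
    exact le_csInf ⟨w, hw, hlw⟩ (hlow l u hu hul)
  have hge : ∀ l ∈ J, ∀ u ∈ I, l < d u → τ l ≤ u := fun l hl u hu hul =>
    csInf_le (hbdd l hl) ⟨hu, hul⟩
  have hτI : ∀ l ∈ J, τ l ∈ I := by
    rintro l hl
    obtain ⟨⟨u, hu, hul⟩, w, hw, hlw⟩ := id hl
    exact hφ.1.ordConnected.out hu hw ⟨hle l hl u hu hul, hge l hl w hw hlw⟩
  have hτmono : MonotoneOn τ J := by
    rintro l hl m hm hlm
    obtain ⟨-, w, hw, hmw⟩ := id hm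
    exact csInf_le_csInf (hbdd l hl) ⟨w, hw, hmw⟩ fun u hu => ⟨hu.1, hlm.trans_lt hu.2⟩
  have hτm : AEMeasurable τ (volume.restrict J) := aemeasurable_restrict_of_monotoneOn hJm hτmono
  refine ⟨(volume.restrict J).map τ, inferInstance, ?_, fun c hc => ⟨d c, fun y hy => ?_⟩⟩
  · rw [Measure.map_apply_of_aemeasurable hτm hI.measurableSet.compl,
      Measure.restrict_apply₀' hJm.nullMeasurableSet]
    convert measure_empty (μ := (volume : Measure ℝ))
    ext l
    simp only [mem_inter_iff, mem_preimage, mem_compl_iff, mem_empty_iff_false, iff_false, not_and]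
    exact fun h hl => h (hτI l hl)
  -- The inequality is strict by right continuity of d. This matches the strict `c < t` in `kink`;
  -- slopes below d c give τ l ≤ c, and the single slope d c is negligible.
  have hgt : ∀ l ∈ J, d c < l → c < τ l := by
    intro l hl hcl
    refine lt_of_le_of_ne (hle l hl c hc hcl.le) fun hEq => ?_
    refine absurd (hφ.le_rightDeriv_of_forall_lt hI (l := l) hc fun u hu hcu => ?_) (not_le.2 hcl)
    by_contra! hlt
    exact absurd (hle l hl u hu hlt.le) (by linarith)
  rw [lintegral_map' (measurable_kink_right c y).aemeasurable hτm, ← lintegral_indicator hJm]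
  have hne : ∀ᵐ l : ℝ, l ≠ d c := by
    simp [ae_iff]
  rcases lt_trichotomy c y with hcy | rfl | hyc
  · obtain ⟨hint, heq⟩ := hφ.intervalIntegral_rightDeriv hI hc hy hcy.le
    have hsub : Icc c y ⊆ I := hφ.1.ordConnected.out hc hy
    have hint2 : IntervalIntegrable (fun u => d u - d c) volume c y :=
      hint.sub intervalIntegrable_const
    have heq2 : φ y - φ c - d c * (y - c) = ∫ u in c..y, (d u - d c) := by
      rw [intervalIntegral.integral_sub hint intervalIntegrable_const, heq]
      simp [mul_comm]
    have hnn : ∀ᵐ u ∂(volume.restrict (Ioc c y)), 0 ≤ d u - d c := by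
      refine (ae_restrict_iff' measurableSet_Ioc).2 (ae_of_all _ fun u hu => ?_)
      exact sub_nonneg.2 (hmono hc (hsub (Ioc_subset_Icc_self hu)) hu.1.le)
    rw [intervalIntegral.integral_of_le hcy.le] at heq2
    constructor
    · have := integral_nonneg_of_ae hnn
      linarith
    · rw [heq2, ofReal_integral_eq_lintegral_ofReal hint2.1 hnn,
        lintegral_ofReal_sub_eq hdm _ _ measurableSet_Ioc]
      -- For a slope l in J above d c, the points u of (c, y] with l < d u form, up to endpoints,
      -- the interval from τ l to y, whose length is the kink at τ l. Slopes below d c contribute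
      -- zero on both sides.
      refine lintegral_congr_ae ?_
      filter_upwards [hne] with l hl
      rcases lt_or_gt_of_ne hl with hlt | hlt
      · have : {u | u ∈ Ioc c y ∧ d c ≤ l ∧ l < d u} = ∅ := by
          ext u; simp [hlt]
        rw [this, measure_empty]
        by_cases hlJ : l ∈ J
        · rw [indicator_of_mem hlJ, kink_eq_zero_of_le_of_le hcy (hge l hlJ c hc hlt)]
        · rw [indicator_of_notMem hlJ]
      · by_cases hlJ : l ∈ J
        · rw [indicator_of_mem hlJ, kink, if_pos (hgt l hlJ hlt)]
          refine le_antisymm ?_ ?_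
          · rw [← Real.volume_Icc]
            refine measure_mono fun u hu => ?_
            exact ⟨hge l hlJ u (hsub (Ioc_subset_Icc_self hu.1)) hu.2.2, hu.1.2⟩
          · rw [← Real.volume_Ioc]
            refine measure_mono fun u hu => ?_
            have hcu : c < u := (hgt l hlJ hlt).trans hu.1
            refine ⟨⟨hcu, hu.2⟩, hlt.le, ?_⟩
            by_contra! hul
            exact absurd (hle l hlJ u (hsub ⟨hcu.le, hu.2⟩) hul) (not_le.2 hu.1)
        · rw [indicator_of_notMem hlJ]
          have : {u | u ∈ Ioc c y ∧ d c ≤ l ∧ l < d u} = ∅ := by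
            refine eq_empty_of_forall_notMem fun u hu => hlJ ⟨⟨c, hc, hlt.le⟩, u, ?_, hu.2.2⟩
            exact hsub (Ioc_subset_Icc_self hu.1)
          rw [this, measure_empty]
  · refine ⟨by simp, ?_⟩
    simp [kink_self]
  · obtain ⟨hint, heq⟩ := hφ.intervalIntegral_rightDeriv hI hy hc hyc.le
    have hsub : Icc y c ⊆ I := hφ.1.ordConnected.out hy hc
    have hint2 : IntervalIntegrable (fun u => d c - d u) volume y c :=
      intervalIntegrable_const.sub hint
    have heq2 : φ y - φ c - d c * (y - c) = ∫ u in y..c, (d c - d u) := by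
      rw [intervalIntegral.integral_sub intervalIntegrable_const hint, heq]
      simp only [intervalIntegral.integral_const, smul_eq_mul]
      ring
    have hnn : ∀ᵐ u ∂(volume.restrict (Ioc y c)), 0 ≤ d c - d u := by
      refine (ae_restrict_iff' measurableSet_Ioc).2 (ae_of_all _ fun u hu => ?_)
      exact sub_nonneg.2 (hmono (hsub (Ioc_subset_Icc_self hu)) hc hu.2)
    rw [intervalIntegral.integral_of_le hyc.le] at heq2
    constructor
    · have := integral_nonneg_of_ae hnn
      linarith
    · rw [heq2, ofReal_integral_eq_lintegral_ofReal hint2.1 hnn,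
        lintegral_ofReal_sub_eq' hdm _ _ measurableSet_Ioc]
      refine lintegral_congr_ae ?_
      filter_upwards [hne] with l hl
      rcases lt_or_gt_of_ne hl with hlt | hlt
      · by_cases hlJ : l ∈ J
        · have hτc := hge l hlJ c hc hlt
          rw [indicator_of_mem hlJ, kink, if_neg (not_lt.2 hτc)]
          refine le_antisymm ?_ ?_
          · rw [← Real.volume_Icc]
            refine measure_mono fun u hu => ?_
            exact ⟨hu.1.1.le, hle l hlJ u (hsub (Ioc_subset_Icc_self hu.1)) hu.2.1⟩
          · rw [← Real.volume_Ioo]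
            refine measure_mono fun u hu => ?_
            have huc : u < c := hu.2.trans_le hτc
            refine ⟨⟨hu.1, huc.le⟩, ?_, hlt⟩
            by_contra! hul
            exact absurd (hge l hlJ u (hsub ⟨hu.1.le, huc.le⟩) hul) (not_le.2 hu.2)
        · rw [indicator_of_notMem hlJ]
          have : {u | u ∈ Ioc y c ∧ d u ≤ l ∧ l < d c} = ∅ := by
            refine eq_empty_of_forall_notMem fun u hu => hlJ ⟨⟨u, ?_, hu.2.1⟩, c, hc, hlt⟩
            exact hsub (Ioc_subset_Icc_self hu.1)
          rw [this, measure_empty]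
      · have : {u | u ∈ Ioc y c ∧ d u ≤ l ∧ l < d c} = ∅ := by
          ext u; simp [hlt.le]
        rw [this, measure_empty]
        by_cases hlJ : l ∈ J
        · rw [indicator_of_mem hlJ, kink_eq_zero_of_lt_of_lt hyc (hgt l hlJ hlt)]
        · rw [indicator_of_notMem hlJ]

end Curvature

/-! ### Convexity of extended nonnegative functions. -/

section ENNRealConvex

lemma ConvexOn.ennreal_le {g : ℝ → ℝ≥0∞} (hg : ConvexOn ℝ≥0 univ g) {a b : ℝ} (ha : 0 ≤ a)
    (hb : 0 ≤ b) (hab : a + b = 1) (x y : ℝ) :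
    g (a * x + b * y) ≤ ENNReal.ofReal a * g x + ENNReal.ofReal b * g y := by
  lift a to ℝ≥0 using ha
  lift b to ℝ≥0 using hb
  rw [ENNReal.ofReal_coe_nnreal, ENNReal.ofReal_coe_nnreal]
  exact hg.2 (mem_univ x) (mem_univ y) zero_le zero_le (by exact_mod_cast hab)

lemma convexOn_ennreal_of_le {g : ℝ → ℝ≥0∞}
    (h : ∀ a b : ℝ, 0 ≤ a → 0 ≤ b → a + b = 1 → ∀ x y : ℝ,
      g (a * x + b * y) ≤ ENNReal.ofReal a * g x + ENNReal.ofReal b * g y) :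
    ConvexOn ℝ≥0 univ g := by
  refine ⟨convex_univ, fun x _ y _ a b _ _ hab => ?_⟩
  have := h a b a.2 b.2 (by exact_mod_cast hab) x y
  rw [ENNReal.ofReal_coe_nnreal, ENNReal.ofReal_coe_nnreal] at this
  exact this

lemma convexOn_ofReal {u : ℝ → ℝ} (hu : ConvexOn ℝ univ u) :
    ConvexOn ℝ≥0 univ fun x => ENNReal.ofReal (u x) := by
  refine convexOn_ennreal_of_le fun a b ha hb hab x y => ?_
  rw [← ENNReal.ofReal_mul ha, ← ENNReal.ofReal_mul hb]
  exact (ENNReal.ofReal_le_ofReal (hu.2 (mem_univ x) (mem_univ y) ha hb hab)).trans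
    ENNReal.ofReal_add_le

lemma convexOn_kink (c t : ℝ) : ConvexOn ℝ≥0 univ fun y => kink c y t := by
  unfold kink
  split_ifs
  · refine convexOn_ofReal ⟨convex_univ, fun x _ y _ a b _ _ hab => le_of_eq ?_⟩
    simp only [smul_eq_mul]
    linear_combination t * hab
  · refine convexOn_ofReal ⟨convex_univ, fun x _ y _ a b _ _ hab => le_of_eq ?_⟩
    simp only [smul_eq_mul]
    linear_combination (-t) * hab

lemma convexOn_lintegral_kink (c : ℝ) (ν : Measure ℝ) :
    ConvexOn ℝ≥0 univ fun y => ∫⁻ t, kink c y t ∂ν := by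
  refine convexOn_ennreal_of_le fun a b ha hb hab x y => ?_
  rw [← lintegral_const_mul _ (measurable_kink_right c x),
    ← lintegral_const_mul _ (measurable_kink_right c y),
    ← lintegral_add_left ((measurable_kink_right c x).const_mul _)]
  exact lintegral_mono fun t => (convexOn_kink c t).ennreal_le ha hb hab x y

/-- If `h + n = g + p` where `g` is convex and the finite function `p - n` is convex, then `h` is
convex. -/
lemma convexOn_of_add_eq_add {g h : ℝ → ℝ≥0∞} {p n : ℝ → ℝ} (hg : ConvexOn ℝ≥0 univ g)
    (hp : ∀ x, 0 ≤ p x) (hn : ∀ x, 0 ≤ n x) (hpn : ConvexOn ℝ univ fun x => p x - n x)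
    (heq : ∀ x, h x + ENNReal.ofReal (n x) = g x + ENNReal.ofReal (p x)) :
    ConvexOn ℝ≥0 univ h := by
  refine convexOn_ennreal_of_le fun a b ha hb hab x y => ?_
  set z := a * x + b * y with hz
  have h1 := hg.ennreal_le ha hb hab x y
  have h2 : p z + (a * n x + b * n y) ≤ (a * p x + b * p y) + n z := by
    have := hpn.2 (mem_univ x) (mem_univ y) ha hb hab
    simp only [smul_eq_mul] at this
    rw [← hz] at this
    linarith
  have h3 : ENNReal.ofReal (p z) + (ENNReal.ofReal a * ENNReal.ofReal (n x) +
        ENNReal.ofReal b * ENNReal.ofReal (n y)) ≤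
      (ENNReal.ofReal a * ENNReal.ofReal (p x) + ENNReal.ofReal b * ENNReal.ofReal (p y)) +
        ENNReal.ofReal (n z) := by
    rw [← ENNReal.ofReal_mul ha, ← ENNReal.ofReal_mul hb, ← ENNReal.ofReal_mul ha,
      ← ENNReal.ofReal_mul hb]
    have i1 := mul_nonneg ha (hn x)
    have i2 := mul_nonneg hb (hn y)
    have i3 := mul_nonneg ha (hp x)
    have i4 := mul_nonneg hb (hp y)
    rw [← ENNReal.ofReal_add i1 i2, ← ENNReal.ofReal_add i3 i4,
      ← ENNReal.ofReal_add (hp z) (by positivity), ← ENNReal.ofReal_add (by positivity) (hn z)]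
    exact ENNReal.ofReal_le_ofReal h2
  set A := ENNReal.ofReal a
  set B := ENNReal.ofReal b
  have hfin : ENNReal.ofReal (n z) + (A * ENNReal.ofReal (n x) + B * ENNReal.ofReal (n y)) ≠ ∞ := by
    finiteness
  refine (ENNReal.add_le_add_iff_right hfin).1 ?_
  calc h z + (ENNReal.ofReal (n z) + (A * ENNReal.ofReal (n x) + B * ENNReal.ofReal (n y)))
      = g z + (ENNReal.ofReal (p z) + (A * ENNReal.ofReal (n x) + B * ENNReal.ofReal (n y))) := by
        rw [← add_assoc, heq, add_assoc]
    _ ≤ (A * g x + B * g y) + ((A * ENNReal.ofReal (p x) + B * ENNReal.ofReal (p y)) +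
        ENNReal.ofReal (n z)) := add_le_add h1 h3
    _ = A * (g x + ENNReal.ofReal (p x)) + B * (g y + ENNReal.ofReal (p y)) +
        ENNReal.ofReal (n z) := by ring
    _ = A * h x + B * h y + (ENNReal.ofReal (n z) +
        (A * ENNReal.ofReal (n x) + B * ENNReal.ofReal (n y))) := by
        rw [← heq, ← heq]; ring

end ENNRealConvex

/-! ### Taylor's formula for coercive closed convex functions, up to the boundary of the domain. -/

/-- The interior of the effective domain. -/
def domInt (g : ℝ → ℝ≥0∞) : Set ℝ := interior {x | g x < ∞}

lemma lt_top_of_mem_domInt {g : ℝ → ℝ≥0∞} {x : ℝ} (hx : x ∈ domInt g) : g x < ∞ :=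
  interior_subset (s := {x | g x < ∞}) hx

/-- `μ` is the second derivative measure of `g`: it lives on the interior of the effective domain,
and Taylor's formula with integral remainder holds on the closure of the effective domain. -/
def IsCurvature (g : ℝ → ℝ≥0∞) (μ : Measure ℝ) : Prop :=
  μ (domInt g)ᶜ = 0 ∧ ∀ c ∈ domInt g, ∃ p : ℝ, ∀ y ∈ closure (domInt g),
    g y + ENNReal.ofReal (-(p * (y - c))) =
      g c + ENNReal.ofReal (p * (y - c)) + ∫⁻ t, kink c y t ∂μ

namespace IsCoerciveClosedConvex

variable {g : ℝ → ℝ≥0∞} (hg : IsCoerciveClosedConvex g)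
include hg

lemma convex_dom : Convex ℝ {x | g x < ∞} := by
  intro x hx y hy a b ha hb hab
  refine (hg.convex.ennreal_le ha hb hab x y).trans_lt ?_
  simp only [mem_ofPred_eq] at hx hy
  finiteness

lemma convex_domInt : Convex ℝ (domInt g) := hg.convex_dom.interior

lemma eq_top_of_notMem_closure {x : ℝ} (hx : x ∉ closure (domInt g)) : g x = ∞ := by
  by_contra h
  refine hx ?_
  rw [domInt, hg.convex_dom.closure_interior_eq_closure_of_nonempty_interior
    hg.interior_dom_nonempty]
  exact subset_closure (lt_top_iff_ne_top.2 h)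

lemma convexOn_toReal : ConvexOn ℝ (domInt g) fun x => (g x).toReal := by
  refine ⟨hg.convex_domInt, fun x hx y hy a b ha hb hab => ?_⟩
  have hx' := lt_top_of_mem_domInt hx
  have hy' := lt_top_of_mem_domInt hy
  have h := hg.convex.ennreal_le ha hb hab x y
  have hfin : ENNReal.ofReal a * g x + ENNReal.ofReal b * g y ≠ ∞ := by finiteness
  refine (ENNReal.toReal_mono hfin h).trans (le_of_eq ?_)
  rw [ENNReal.toReal_add (by finiteness) (by finiteness), ENNReal.toReal_mul, ENNReal.toReal_mul,
    ENNReal.toReal_ofReal ha, ENNReal.toReal_ofReal hb]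
  rfl

lemma measurable : Measurable g := hg.closed.measurable

/-- Lower semicontinuity bounds the limit from below and convexity on the chord from above. It
carries Taylor's formula to the endpoints of the domain, including those where g is infinite. -/
lemma tendsto_segment (c y : ℝ) (hc : g c < ∞) {θ : ℕ → ℝ} (h0 : ∀ n, 0 ≤ θ n)
    (h1 : ∀ n, θ n ≤ 1) (hθ : Tendsto θ atTop (𝓝 1)) :
    Tendsto (fun n => g (c + θ n * (y - c))) atTop (𝓝 (g y)) := by
  have hlim : Tendsto (fun n => c + θ n * (y - c)) atTop (𝓝 y) := by
    have := (hθ.mul_const (y - c)).const_add c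
    simpa using this
  refine tendsto_order.2 ⟨fun a ha => hlim.eventually (hg.closed y a ha), fun b hb => ?_⟩
  have hy : g y ≠ ∞ := hb.ne_top
  have hub : Tendsto (fun n => ENNReal.ofReal (1 - θ n) * g c + ENNReal.ofReal (θ n) * g y) atTop
      (𝓝 (ENNReal.ofReal (1 - 1) * g c + ENNReal.ofReal 1 * g y)) := by
    refine Tendsto.add ?_ ?_
    · exact ENNReal.Tendsto.mul_const (ENNReal.tendsto_ofReal (hθ.const_sub 1)) (Or.inr hc.ne)
    · exact ENNReal.Tendsto.mul_const (ENNReal.tendsto_ofReal hθ) (Or.inr hy)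
  simp only [sub_self, ENNReal.ofReal_zero, zero_mul, ENNReal.ofReal_one, one_mul, zero_add] at hub
  filter_upwards [hub.eventually (gt_mem_nhds hb)] with n hn
  refine lt_of_le_of_lt ?_ hn
  have e : c + θ n * (y - c) = (1 - θ n) * c + θ n * y := by ring
  rw [e]
  exact hg.convex.ennreal_le (sub_nonneg.2 (h1 n)) (h0 n) (by ring) c y

theorem exists_isCurvature : ∃ μ : Measure ℝ, SFinite μ ∧ IsCurvature g μ := by
  obtain ⟨μ, hμ, hμ0, h⟩ := hg.convexOn_toReal.exists_curvature isOpen_interior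
  refine ⟨μ, hμ, hμ0, fun c hc => ?_⟩
  obtain ⟨p, hp⟩ := h c hc
  have hfin : ∀ x ∈ domInt g, g x ≠ ∞ := fun x hx => (lt_top_of_mem_domInt hx).ne
  have hint : ∀ y ∈ domInt g, g y + ENNReal.ofReal (-(p * (y - c))) =
      g c + ENNReal.ofReal (p * (y - c)) + ∫⁻ t, kink c y t ∂μ := by
    intro y hy
    obtain ⟨h1, h2⟩ := hp y hy
    rw [← h2]
    have e1 := ENNReal.ofReal_toReal (hfin y hy)
    have e2 := ENNReal.ofReal_toReal (hfin c hc)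
    have n1 : 0 ≤ (g y).toReal := ENNReal.toReal_nonneg
    have n2 : 0 ≤ (g c).toReal := ENNReal.toReal_nonneg
    rw [← e1, ← e2, ENNReal.toReal_ofReal n1, ENNReal.toReal_ofReal n2]
    rcases le_total 0 (p * (y - c)) with h0 | h0
    · rw [ENNReal.ofReal_of_nonpos (neg_nonpos.2 h0), add_zero, ← ENNReal.ofReal_add n2 h0,
        ← ENNReal.ofReal_add (by positivity) (by linarith)]
      congr 1; ring
    · rw [ENNReal.ofReal_of_nonpos h0, add_zero, ← ENNReal.ofReal_add n1 (by linarith),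
        ← ENNReal.ofReal_add n2 (by linarith)]
      congr 1; ring
  refine ⟨p, fun y hy => ?_⟩
  -- An endpoint is approached along the segment from c, whose earlier points are interior. Since θ
  -- increases, the kinks increase along the sequence and monotone convergence applies.
  set θ : ℕ → ℝ := fun n => 1 - 1 / ((n : ℝ) + 1) with hθ
  have hθ1 : ∀ n, θ n < 1 := fun n => by
    simp only [hθ, sub_lt_self_iff]; positivity
  have hθ0 : ∀ n, 0 ≤ θ n := fun n => by
    simp only [hθ, sub_nonneg]
    rw [div_le_one (by positivity)]
    linarith [(Nat.cast_nonneg n : (0 : ℝ) ≤ n)]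
  have hθmono : Monotone θ := fun m n hmn => by
    simp only [hθ]
    gcongr
  have hθlim : Tendsto θ atTop (𝓝 1) := by
    simpa [hθ] using (tendsto_one_div_add_atTop_nhds_zero_nat (𝕜 := ℝ)).const_sub 1
  have hmem : ∀ n, c + θ n * (y - c) ∈ domInt g := fun n => by
    have := hg.convex_domInt.combo_interior_closure_mem_interior (x := c) (y := y)
      (by rwa [domInt, interior_interior]) hy (sub_pos.2 (hθ1 n)) (hθ0 n) (by ring)
    rw [domInt, interior_interior] at this
    have e : c + θ n * (y - c) = (1 - θ n) • c + θ n • y := by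
      simp only [smul_eq_mul]; ring
    rw [e]
    exact this
  have hlim : Tendsto (fun n => c + θ n * (y - c)) atTop (𝓝 y) := by
    simpa using (hθlim.mul_const (y - c)).const_add c
  have hgl := hg.tendsto_segment c y (lt_top_iff_ne_top.2 (hfin c hc)) hθ0 (fun n => (hθ1 n).le) hθlim
  have hkl : Tendsto (fun n => ∫⁻ t, kink c (c + θ n * (y - c)) t ∂μ) atTop
      (𝓝 (∫⁻ t, kink c y t ∂μ)) := by
    refine lintegral_tendsto_of_tendsto_of_monotone
      (fun n => (measurable_kink_right c _).aemeasurable) (ae_of_all _ fun t m n hmn => ?_)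
      (ae_of_all _ fun t => ?_)
    · have hm := hθmono hmn
      have hm0 := hθ0 m
      simp only [kink]
      split_ifs with hct
      · rcases le_total c y with hcy | hcy
        · refine ENNReal.ofReal_le_ofReal ?_
          have := mul_le_mul_of_nonneg_right hm (sub_nonneg.2 hcy)
          linarith
        · rw [ENNReal.ofReal_of_nonpos]
          · exact zero_le
          · have := mul_nonneg hm0 (sub_nonneg.2 hcy)
            linarith
      · rcases le_total c y with hcy | hcy
        · rw [ENNReal.ofReal_of_nonpos]
          · exact zero_le
          · have := mul_nonneg hm0 (sub_nonneg.2 hcy)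
            linarith
        · refine ENNReal.ofReal_le_ofReal ?_
          have := mul_le_mul_of_nonneg_right hm (sub_nonneg.2 hcy)
          linarith
    · simp only [kink]
      split_ifs with hct
      · exact ENNReal.tendsto_ofReal (hlim.sub_const t)
      · exact ENNReal.tendsto_ofReal (hlim.const_sub t)
  have hL : Tendsto (fun n => p * (c + θ n * (y - c) - c)) atTop (𝓝 (p * (y - c))) :=
    (hlim.sub_const c).const_mul p
  have l1 := hgl.add (ENNReal.tendsto_ofReal hL.neg)
  have l2 := (tendsto_const_nhds (x := g c)).add (ENNReal.tendsto_ofReal hL) |>.add hkl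
  refine tendsto_nhds_unique l1 (l2.congr fun n => ?_)
  exact (hint _ (hmem n)).symm

end IsCoerciveClosedConvex

/-! ### The second derivative measure and the points of strict convexity. -/

section CurvatureAffine

variable {g : ℝ → ℝ≥0∞} {μ : Measure ℝ}

/-- The sum is the tent (δ - |t - x|)⁺, the kernel of the symmetric second difference. -/
lemma kink_add_kink_pos {x δ t : ℝ} (ht : t ∈ Ioo (x - δ) (x + δ)) :
    0 < kink x (x + δ) t + kink x (x - δ) t := by
  unfold kink
  split_ifs with h
  · exact (ENNReal.ofReal_pos.2 (by linarith [ht.2])).trans_le le_self_add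
  · exact (ENNReal.ofReal_pos.2 (by linarith [ht.1])).trans_le le_add_self

lemma kink_add_kink_eq_zero {x δ t : ℝ} (hδ : 0 < δ) (ht : t ∉ Ioo (x - δ) (x + δ)) :
    kink x (x + δ) t + kink x (x - δ) t = 0 := by
  rw [mem_Ioo, not_and_or, not_lt, not_lt] at ht
  unfold kink
  split_ifs with h
  · rw [ENNReal.ofReal_of_nonpos, ENNReal.ofReal_of_nonpos, add_zero]
    · linarith
    · rcases ht with ht | ht <;> linarith
  · rw [ENNReal.ofReal_of_nonpos, ENNReal.ofReal_of_nonpos, add_zero]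
    · rcases ht with ht | ht <;> linarith
    · linarith

lemma lintegral_kink_add_eq_zero_iff {x δ : ℝ} :
    ∫⁻ t, (kink x (x + δ) t + kink x (x - δ) t) ∂μ = 0 ↔
      (fun t => kink x (x + δ) t + kink x (x - δ) t) =ᵐ[μ] 0 :=
  lintegral_eq_zero_iff ((measurable_kink_right _ _).add (measurable_kink_right _ _))

namespace IsCurvature

variable (hμ : IsCurvature g μ)
include hμ

lemma second_difference {x δ : ℝ} (hx : x ∈ domInt g) (h1 : x + δ ∈ domInt g)
    (h2 : x - δ ∈ domInt g) :
    g (x + δ) + g (x - δ) =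
      g x + g x + ∫⁻ t, (kink x (x + δ) t + kink x (x - δ) t) ∂μ := by
  obtain ⟨p, hp⟩ := hμ.2 x hx
  have e1 := hp _ (subset_closure h1)
  have e2 := hp _ (subset_closure h2)
  rw [add_sub_cancel_left] at e1
  rw [show p * (x - δ - x) = -(p * δ) by ring, neg_neg] at e2
  rw [lintegral_add_left (measurable_kink_right _ _)]
  set a := ENNReal.ofReal (p * δ) with ha
  set b := ENNReal.ofReal (-(p * δ)) with hb
  have hfin : a + b ≠ ∞ := by finiteness
  refine (ENNReal.add_left_inj hfin).1 ?_
  calc g (x + δ) + g (x - δ) + (a + b) = (g (x + δ) + b) + (g (x - δ) + a) := by ring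
    _ = _ := by rw [e1, e2]; ring

lemma measure_Ioo_eq_zero_of_le {x δ : ℝ} (hx : x ∈ domInt g)
    (h1 : x + δ ∈ domInt g) (h2 : x - δ ∈ domInt g) (h : (g (x + δ) + g (x - δ)) / 2 ≤ g x) :
    μ (Ioo (x - δ) (x + δ)) = 0 := by
  have hfin : g x ≠ ∞ := (lt_top_of_mem_domInt hx).ne
  have e := hμ.second_difference hx h1 h2
  rw [ENNReal.div_le_iff (by norm_num) (by norm_num), e, mul_two] at h
  have h0 : ∫⁻ t, (kink x (x + δ) t + kink x (x - δ) t) ∂μ = 0 := by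
    have hf2 : g x + g x ≠ ∞ := by finiteness
    refine nonpos_iff_eq_zero.1 ((ENNReal.add_le_add_iff_left hf2).1 ?_)
    simpa using h
  rw [lintegral_kink_add_eq_zero_iff] at h0
  refine measure_mono_null (fun t ht => ?_) (ae_iff.1 h0)
  exact (kink_add_kink_pos ht).ne'

lemma measure_Ioo_ne_zero_of_lt {x δ : ℝ} (hδ : 0 < δ) (hx : x ∈ domInt g)
    (h1 : x + δ ∈ domInt g) (h2 : x - δ ∈ domInt g) (h : g x < (g (x + δ) + g (x - δ)) / 2) :
    μ (Ioo (x - δ) (x + δ)) ≠ 0 := by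
  intro h0
  rw [hμ.second_difference hx h1 h2] at h
  have : ∫⁻ t, (kink x (x + δ) t + kink x (x - δ) t) ∂μ = 0 := by
    rw [lintegral_kink_add_eq_zero_iff]
    refine ae_iff.2 (measure_mono_null (fun t ht => ?_) h0)
    by_contra hn
    exact ht (kink_add_kink_eq_zero hδ hn)
  rw [this, add_zero, ← mul_two, ENNReal.mul_div_cancel_right (by norm_num) (by norm_num)] at h
  exact lt_irrefl _ h

omit hμ in
lemma eventually_add_sub_mem {x : ℝ} (hx : x ∈ domInt g) :
    ∀ᶠ δ in 𝓝[>] (0 : ℝ), x + δ ∈ domInt g ∧ x - δ ∈ domInt g := by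
  have hn : domInt g ∈ 𝓝 x := isOpen_interior.mem_nhds hx
  have h1 : Tendsto (fun δ : ℝ => x + δ) (𝓝[>] 0) (𝓝 x) := by
    have : Tendsto (fun δ : ℝ => x + δ) (𝓝 0) (𝓝 (x + 0)) := by
      exact (continuous_const.add continuous_id).tendsto 0
    rw [add_zero] at this
    exact this.mono_left nhdsWithin_le_nhds
  have h2 : Tendsto (fun δ : ℝ => x - δ) (𝓝[>] 0) (𝓝 x) := by
    have : Tendsto (fun δ : ℝ => x - δ) (𝓝 0) (𝓝 (x - 0)) := by
      exact (continuous_const.sub continuous_id).tendsto 0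
    rw [sub_zero] at this
    exact this.mono_left nhdsWithin_le_nhds
  exact (h1.eventually hn).and (h2.eventually hn)

lemma eventually_measure_Ioo_ne_zero {x : ℝ} (hx : x ∈ domInt g)
    (hS : x ∈ strictConvexityPoints g) :
    ∀ᶠ δ in 𝓝[>] (0 : ℝ), μ (Ioo (x - δ) (x + δ)) ≠ 0 := by
  filter_upwards [eventually_add_sub_mem hx, hS, self_mem_nhdsWithin] with δ h1 h2 h3
  exact hμ.measure_Ioo_ne_zero_of_lt h3 hx h1.1 h1.2 h2

/-- At any other point of the interior there is a δ > 0 whose second difference is not positive; the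
tent then integrates to zero, so the point has a null neighbourhood. A locally null set is null. -/
lemma ae_mem_strictConvexityPoints : ∀ᵐ t ∂μ, t ∈ strictConvexityPoints g := by
  have h : μ (domInt g \ strictConvexityPoints g) = 0 := by
    refine measure_null_of_locally_null _ fun x hx => ?_
    have hfr : ∃ᶠ δ in 𝓝[>] (0 : ℝ), ¬ g x < (g (x + δ) + g (x - δ)) / 2 :=
      not_eventually.1 hx.2
    obtain ⟨δ, h1, h2, h3⟩ :=
      (hfr.and_eventually ((eventually_add_sub_mem hx.1).and self_mem_nhdsWithin)).exists
    have h3' : 0 < δ := h3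
    exact ⟨Ioo (x - δ) (x + δ), mem_nhdsWithin_of_mem_nhds
      (Ioo_mem_nhds (by linarith) (by linarith)),
      hμ.measure_Ioo_eq_zero_of_le hx.1 h2.1 h2.2 (not_lt.1 h1)⟩
  refine ae_iff.2 (measure_mono_null (fun t ht => ?_) (measure_union_null hμ.1 h))
  by_cases htI : t ∈ domInt g
  · exact Or.inr ⟨htI, ht⟩
  · exact Or.inl htI

lemma lintegral_kink_lt_top {c y : ℝ} (hc : c ∈ domInt g) (hy : y ∈ domInt g) :
    ∫⁻ t, kink c y t ∂μ < ∞ := by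
  obtain ⟨p, hp⟩ := hμ.2 c hc
  have e := hp y (subset_closure hy)
  have := lt_top_of_mem_domInt hy
  refine lt_of_le_of_lt ?_ (show g y + ENNReal.ofReal (-(p * (y - c))) < ∞ by finiteness)
  rw [e]
  exact le_add_self

/-- On (a, b] the kink based at a and evaluated slightly beyond b, at b + δ, is at least δ, and its
integral is finite. -/
lemma measure_Ioc_lt_top {a b : ℝ} (ha : a ∈ domInt g) (hb : b ∈ domInt g) :
    μ (Ioc a b) < ∞ := by
  obtain ⟨δ, ⟨hy, -⟩, hδ⟩ := ((eventually_add_sub_mem hb).and self_mem_nhdsWithin).exists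
  have hδ' : 0 < δ := hδ
  have hle : ENNReal.ofReal δ * μ (Ioc a b) ≤ ∫⁻ t, kink a (b + δ) t ∂μ := by
    rw [← setLIntegral_const]
    refine (setLIntegral_mono' measurableSet_Ioc fun t ht => ?_).trans (setLIntegral_le_lintegral _ _)
    rw [kink, if_pos ht.1]
    exact ENNReal.ofReal_le_ofReal (by linarith [ht.2])
  have h2 := hle.trans_lt (hμ.lintegral_kink_lt_top ha hy)
  by_contra h
  rw [not_lt, top_le_iff] at h
  rw [h, ENNReal.mul_top (ENNReal.ofReal_pos.2 hδ').ne'] at h2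
  exact lt_irrefl _ h2

end IsCurvature

end CurvatureAffine

/-! ### Partial moments and comparison of integrals of convex functions. -/

/-- The lower partial moment `∫ (t - y)⁺ dP(y)`. -/
noncomputable def lowerMoment (P : Measure ℝ) (t : ℝ) : ℝ≥0∞ := ∫⁻ y, ENNReal.ofReal (t - y) ∂P

/-- The upper partial moment `∫ (y - t)⁺ dP(y)`. -/
noncomputable def upperMoment (P : Measure ℝ) (t : ℝ) : ℝ≥0∞ := ∫⁻ y, ENNReal.ofReal (y - t) ∂P

section PartialMoments

variable {P Q : Measure ℝ}

lemma lowerMoment_mono (P : Measure ℝ) : Monotone (lowerMoment P) := fun _ _ h =>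
  lintegral_mono fun _ => ENNReal.ofReal_le_ofReal (by linarith)

lemma upperMoment_anti (P : Measure ℝ) : Antitone (upperMoment P) := fun _ _ h =>
  lintegral_mono fun _ => ENNReal.ofReal_le_ofReal (by linarith)

lemma lowerMoment_eq_zero_iff {t : ℝ} : lowerMoment P t = 0 ↔ ∀ᵐ y ∂P, t ≤ y := by
  rw [lowerMoment, lintegral_eq_zero_iff (by fun_prop)]
  refine eventually_congr (ae_of_all _ fun y => ?_)
  simp

lemma upperMoment_eq_zero_iff {t : ℝ} : upperMoment P t = 0 ↔ ∀ᵐ y ∂P, y ≤ t := by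
  rw [upperMoment, lintegral_eq_zero_iff (by fun_prop)]
  refine eventually_congr (ae_of_all _ fun y => ?_)
  simp

/-- A measure without partial moments outside a closed interval is carried by it. -/
lemma ae_mem_of_moments_eq_zero {C : Set ℝ} (hC : IsClosed C) (hconv : OrdConnected C)
    (hl : ∀ z, (∀ y ∈ C, z < y) → lowerMoment P z = 0)
    (hu : ∀ z, (∀ y ∈ C, y < z) → upperMoment P z = 0) : ∀ᵐ y ∂P, y ∈ C := by
  refine ae_iff.2 ?_
  refine measure_null_of_locally_null _ fun x hx => ?_
  obtain ⟨ε, hε, hball⟩ := Metric.isOpen_iff.1 hC.isOpen_compl x hx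
  rw [Real.ball_eq_Ioo] at hball
  by_cases h : ∀ y ∈ C, x < y
  · refine ⟨Iio (x + ε / 2), mem_nhdsWithin_of_mem_nhds (Iio_mem_nhds (by linarith)), ?_⟩
    have := hl (x + ε / 2) fun y hy => by
      by_contra! hle
      exact hball ⟨by linarith [h y hy], by linarith⟩ hy
    rw [lowerMoment_eq_zero_iff, ae_iff] at this
    simpa [Iio] using this
  · refine ⟨Ioi (x - ε / 2), mem_nhdsWithin_of_mem_nhds (Ioi_mem_nhds (by linarith)), ?_⟩
    push Not at h
    obtain ⟨w, hw, hwx⟩ := h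
    have := hu (x - ε / 2) fun y hy => by
      by_contra! hle
      rcases le_total x y with hxy | hxy
      · exact hx (hconv.out hw hy ⟨hwx, hxy⟩)
      · exact hball ⟨by linarith, by linarith⟩ hy
    rw [upperMoment_eq_zero_iff, ae_iff] at this
    simpa [Ioi] using this

lemma lowerMoment_eq_zero_of_ae {C : Set ℝ} (h : ∀ᵐ y ∂P, y ∈ C) {z : ℝ} (hz : ∀ y ∈ C, z ≤ y) :
    lowerMoment P z = 0 :=
  lowerMoment_eq_zero_iff.2 (h.mono hz)

lemma upperMoment_eq_zero_of_ae {C : Set ℝ} (h : ∀ᵐ y ∂P, y ∈ C) {z : ℝ} (hz : ∀ y ∈ C, y ≤ z) :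
    upperMoment P z = 0 :=
  upperMoment_eq_zero_iff.2 (h.mono hz)

lemma ae_mem_of_moments_le {C : Set ℝ} (hC : IsClosed C) (hconv : OrdConnected C)
    (hl : ∀ z, lowerMoment P z ≤ lowerMoment Q z) (hu : ∀ z, upperMoment P z ≤ upperMoment Q z)
    (hQ : ∀ᵐ y ∂Q, y ∈ C) : ∀ᵐ y ∂P, y ∈ C := by
  refine ae_mem_of_moments_eq_zero hC hconv (fun z hz => ?_) fun z hz => ?_
  · exact nonpos_iff_eq_zero.1 ((hl z).trans
      (lowerMoment_eq_zero_of_ae hQ fun y hy => (hz y hy).le).le)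
  · exact nonpos_iff_eq_zero.1 ((hu z).trans
      (upperMoment_eq_zero_of_ae hQ fun y hy => (hz y hy).le).le)

variable [IsProbabilityMeasure P] [IsProbabilityMeasure Q]

lemma lowerMoment_lt_top (hP : Integrable (fun x : ℝ => x) P) (t : ℝ) : lowerMoment P t < ∞ :=
  ((integrable_const t).sub hP).lintegral_lt_top

lemma upperMoment_lt_top (hP : Integrable (fun x : ℝ => x) P) (t : ℝ) : upperMoment P t < ∞ :=
  (hP.sub (integrable_const t)).lintegral_lt_top

lemma upperMoment_sub_lowerMoment (hP : Integrable (fun x : ℝ => x) P) (t : ℝ) :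
    (upperMoment P t).toReal - (lowerMoment P t).toReal = ∫ y, y ∂P - t := by
  have h := integral_eq_lintegral_pos_part_sub_lintegral_neg_part (hP.sub (integrable_const t))
  simp only [Pi.sub_apply, neg_sub] at h
  rw [integral_sub hP (integrable_const t), integral_const] at h
  simp only [probReal_univ, one_smul] at h
  exact h.symm

/-- The difference of the upper and lower moments is the mean minus t, hence the same for P and Q.
So one condition on lower moments controls the kinks on both sides of the base point. -/
lemma upperMoment_le_iff (hP : Integrable (fun x : ℝ => x) P) (hQ : Integrable (fun x : ℝ => x) Q)
    (hm : ∫ y, y ∂P = ∫ y, y ∂Q) (t : ℝ) :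
    upperMoment P t ≤ upperMoment Q t ↔ lowerMoment P t ≤ lowerMoment Q t := by
  have h1 := upperMoment_sub_lowerMoment hP t
  have h2 := upperMoment_sub_lowerMoment hQ t
  rw [← ENNReal.toReal_le_toReal (upperMoment_lt_top hP t).ne (upperMoment_lt_top hQ t).ne,
    ← ENNReal.toReal_le_toReal (lowerMoment_lt_top hP t).ne (lowerMoment_lt_top hQ t).ne]
  constructor <;> intro h <;> linarith

lemma lowerMoment_le_add (P : Measure ℝ) [IsProbabilityMeasure P] (t u : ℝ) :
    lowerMoment P t ≤ lowerMoment P u + ENNReal.ofReal (t - u) := by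
  have : ENNReal.ofReal (t - u) = ∫⁻ _, ENNReal.ofReal (t - u) ∂P := by simp
  rw [this, lowerMoment, lowerMoment, ← lintegral_add_left (by fun_prop)]
  refine lintegral_mono fun y => ?_
  refine le_trans (ENNReal.ofReal_le_ofReal (le_of_eq ?_)) ENNReal.ofReal_add_le
  ring

omit [IsProbabilityMeasure P] [IsProbabilityMeasure Q] in
-- Subtraction-free form of equality of integrals, used for the linear term of Taylor's formula.
lemma lintegral_ofReal_add_eq {u : ℝ → ℝ} (hu : Integrable u P) (hu' : Integrable u Q)
    (h : ∫ y, u y ∂P = ∫ y, u y ∂Q) :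
    ∫⁻ y, ENNReal.ofReal (u y) ∂P + ∫⁻ y, ENNReal.ofReal (-u y) ∂Q =
      ∫⁻ y, ENNReal.ofReal (u y) ∂Q + ∫⁻ y, ENNReal.ofReal (-u y) ∂P := by
  rw [integral_eq_lintegral_pos_part_sub_lintegral_neg_part hu,
    integral_eq_lintegral_pos_part_sub_lintegral_neg_part hu'] at h
  have f1 := hu.lintegral_lt_top
  have f2 := hu'.lintegral_lt_top
  have f3 := hu.neg.lintegral_lt_top
  have f4 := hu'.neg.lintegral_lt_top
  simp only [Pi.neg_apply] at f3 f4
  rw [← ENNReal.toReal_eq_toReal_iff' (by finiteness) (by finiteness),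
    ENNReal.toReal_add f1.ne f4.ne, ENNReal.toReal_add f2.ne f3.ne]
  linarith

/-- Comparison of integrals of a convex function through partial moments at the points of its
second derivative measure. -/
theorem IsCurvature.lintegral_le {g : ℝ → ℝ≥0∞} {μ : Measure ℝ} [SFinite μ]
    (hg : IsCoerciveClosedConvex g) (hμ : IsCurvature g μ)
    (hP : Integrable (fun x : ℝ => x) P) (hQ : Integrable (fun x : ℝ => x) Q)
    (hm : ∫ y, y ∂P = ∫ y, y ∂Q) (hPI : ∀ᵐ y ∂P, y ∈ closure (domInt g))
    (hQI : ∀ᵐ y ∂Q, y ∈ closure (domInt g))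
    (hle : ∀ᵐ t ∂μ, lowerMoment P t ≤ lowerMoment Q t) :
    ∫⁻ y, g y ∂P ≤ ∫⁻ y, g y ∂Q := by
  obtain ⟨c, hc⟩ := hg.interior_dom_nonempty
  obtain ⟨p, hp⟩ := hμ.2 c hc
  -- Taylor's formula is integrated against ν. By Tonelli the kink at t becomes the upper moment at
  -- t for t > c and the lower moment otherwise.
  have hrep : ∀ (ν : Measure ℝ) [IsProbabilityMeasure ν], (∀ᵐ y ∂ν, y ∈ closure (domInt g)) →
      ∫⁻ y, g y ∂ν + ∫⁻ y, ENNReal.ofReal (-(p * (y - c))) ∂ν =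
        g c + ∫⁻ y, ENNReal.ofReal (p * (y - c)) ∂ν +
          ∫⁻ t, (if c < t then upperMoment ν t else lowerMoment ν t) ∂μ := by
    intro ν _ hν
    rw [← lintegral_add_left hg.measurable, lintegral_congr_ae (hν.mono fun y hy => hp y hy),
      lintegral_add_left (by fun_prop), lintegral_add_left (by fun_prop), lintegral_const,
      measure_univ, mul_one]
    congr 1
    rw [lintegral_lintegral_swap (measurable_kink c).aemeasurable]
    refine lintegral_congr fun t => ?_
    simp only [kink, upperMoment, lowerMoment]
    split_ifs <;> rfl
  have eP := hrep P hPI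
  have eQ := hrep Q hQI
  have iP : Integrable (fun y => p * (y - c)) P := (hP.sub (integrable_const c)).const_mul p
  have iQ : Integrable (fun y => p * (y - c)) Q := (hQ.sub (integrable_const c)).const_mul p
  have hSR := lintegral_ofReal_add_eq iP iQ (by
    rw [integral_const_mul, integral_const_mul, integral_sub hP (integrable_const c),
      integral_sub hQ (integrable_const c), hm]
    simp)
  have hK : ∫⁻ t, (if c < t then upperMoment P t else lowerMoment P t) ∂μ ≤
      ∫⁻ t, (if c < t then upperMoment Q t else lowerMoment Q t) ∂μ := by
    refine lintegral_mono_ae (hle.mono fun t ht => ?_)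
    split_ifs
    · exact (upperMoment_le_iff hP hQ hm t).2 ht
    · exact ht
  have f1 : ∫⁻ y, ENNReal.ofReal (-(p * (y - c))) ∂P < ∞ := iP.neg.lintegral_lt_top
  have f2 : ∫⁻ y, ENNReal.ofReal (-(p * (y - c))) ∂Q < ∞ := iQ.neg.lintegral_lt_top
  set RP := ∫⁻ y, ENNReal.ofReal (-(p * (y - c))) ∂P
  set RQ := ∫⁻ y, ENNReal.ofReal (-(p * (y - c))) ∂Q
  set SP := ∫⁻ y, ENNReal.ofReal (p * (y - c)) ∂P
  set SQ := ∫⁻ y, ENNReal.ofReal (p * (y - c)) ∂Q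
  set KP := ∫⁻ t, (if c < t then upperMoment P t else lowerMoment P t) ∂μ
  set KQ := ∫⁻ t, (if c < t then upperMoment Q t else lowerMoment Q t) ∂μ
  have hf : RP + RQ ≠ ∞ := by finiteness
  refine (ENNReal.add_le_add_iff_right hf).1 ?_
  calc ∫⁻ y, g y ∂P + (RP + RQ) = (∫⁻ y, g y ∂P + RP) + RQ := by ring
    _ = g c + (SP + RQ) + KP := by rw [eP]; ring
    _ = g c + (SQ + RP) + KP := by rw [hSR]
    _ ≤ g c + (SQ + RP) + KQ := by gcongr
    _ = (∫⁻ y, g y ∂Q + RQ) + RP := by rw [eQ]; ring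
    _ = ∫⁻ y, g y ∂Q + (RP + RQ) := by ring

end PartialMoments

/-! ### Integrals of distribution functions as partial moments. -/

section CdfIntegrals

variable {P Q : Measure ℝ}

lemma setLIntegral_measure_Iic [SFinite P] (x : ℝ) :
    ∫⁻ t in Iic x, P (Iic t) = lowerMoment P x := by
  have hS : MeasurableSet {z : ℝ × ℝ | z.1 ≤ x ∧ z.2 ≤ z.1} :=
    (measurableSet_le measurable_fst measurable_const).inter
      (measurableSet_le measurable_snd measurable_fst)
  have h := Measure.prod_apply (μ := (volume : Measure ℝ)) (ν := P) hS
  rw [Measure.prod_apply_symm hS] at h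
  rw [← lintegral_indicator measurableSet_Iic]
  refine Eq.trans (lintegral_congr fun t => ?_) (h.symm.trans (lintegral_congr fun y => ?_))
  · by_cases ht : t ∈ Iic x
    · rw [indicator_of_mem ht]
      congr 1; ext y; simp [mem_Iic.1 ht]
    · rw [indicator_of_notMem ht]
      have : Prod.mk t ⁻¹' {z : ℝ × ℝ | z.1 ≤ x ∧ z.2 ≤ z.1} = ∅ := by
        ext y; simp [notMem_Iic.1 ht]
      rw [this, measure_empty]
  · have : (fun t => (t, y)) ⁻¹' {z : ℝ × ℝ | z.1 ≤ x ∧ z.2 ≤ z.1} = Icc y x := by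
      ext t; simp [and_comm]
    rw [this, Real.volume_Icc]

lemma setLIntegral_measure_Ioi [SFinite P] (x : ℝ) :
    ∫⁻ t in Ioi x, P (Ioi t) = upperMoment P x := by
  have hS : MeasurableSet {z : ℝ × ℝ | x < z.1 ∧ z.1 < z.2} :=
    (measurableSet_lt measurable_const measurable_fst).inter
      (measurableSet_lt measurable_fst measurable_snd)
  have h := Measure.prod_apply (μ := (volume : Measure ℝ)) (ν := P) hS
  rw [Measure.prod_apply_symm hS] at h
  rw [← lintegral_indicator measurableSet_Ioi]
  refine Eq.trans (lintegral_congr fun t => ?_) (h.symm.trans (lintegral_congr fun y => ?_))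
  · by_cases ht : t ∈ Ioi x
    · rw [indicator_of_mem ht]
      congr 1; ext y; simp [mem_Ioi.1 ht]
    · rw [indicator_of_notMem ht]
      have : Prod.mk t ⁻¹' {z : ℝ × ℝ | x < z.1 ∧ z.1 < z.2} = ∅ := by
        ext y; simp [notMem_Ioi.1 ht]
      rw [this, measure_empty]
  · have : (fun t => (t, y)) ⁻¹' {z : ℝ × ℝ | x < z.1 ∧ z.1 < z.2} = Ioo x y := by
      ext t; simp
    rw [this, Real.volume_Ioo]

variable [IsProbabilityMeasure P] [IsProbabilityMeasure Q]

lemma integrableOn_cdf (hP : Integrable (fun x : ℝ => x) P) (x : ℝ) :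
    IntegrableOn (fun t => cdf P t) (Iic x) ∧
      ∫ t in Iic x, cdf P t = (lowerMoment P x).toReal := by
  have hm : Measurable fun t => P (Iic t) :=
    Monotone.measurable fun a b hab => measure_mono (Iic_subset_Iic.2 hab)
  have hfin : ∫⁻ t in Iic x, P (Iic t) ≠ ∞ := by
    rw [setLIntegral_measure_Iic]
    exact (lowerMoment_lt_top hP x).ne
  have he : (fun t => (cdf P t : ℝ)) = fun t => (P (Iic t)).toReal := by
    ext t; rw [cdf_eq_real, measureReal_def]
  rw [he, IntegrableOn]
  refine ⟨integrable_toReal_of_lintegral_ne_top hm.aemeasurable hfin, ?_⟩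
  rw [integral_toReal hm.aemeasurable (ae_of_all _ fun t => measure_lt_top _ _),
    setLIntegral_measure_Iic]

lemma integrableOn_one_sub_cdf (hP : Integrable (fun x : ℝ => x) P) (x : ℝ) :
    IntegrableOn (fun t => 1 - cdf P t) (Ioi x) ∧
      ∫ t in Ioi x, (1 - cdf P t) = (upperMoment P x).toReal := by
  have hm : Measurable fun t => P (Ioi t) :=
    Antitone.measurable fun a b hab => measure_mono (Ioi_subset_Ioi hab)
  have hfin : ∫⁻ t in Ioi x, P (Ioi t) ≠ ∞ := by
    rw [setLIntegral_measure_Ioi]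
    exact (upperMoment_lt_top hP x).ne
  have he : (fun t => 1 - (cdf P t : ℝ)) = fun t => (P (Ioi t)).toReal := by
    ext t
    rw [cdf_eq_real, ← measureReal_def, ← compl_Iic, measureReal_compl measurableSet_Iic,
      probReal_univ]
  rw [he, IntegrableOn]
  refine ⟨integrable_toReal_of_lintegral_ne_top hm.aemeasurable hfin, ?_⟩
  rw [integral_toReal hm.aemeasurable (ae_of_all _ fun t => measure_lt_top _ _),
    setLIntegral_measure_Ioi]

lemma setIntegral_Iic_cdf_sub_cdf (hP : Integrable (fun x : ℝ => x) P)
    (hQ : Integrable (fun x : ℝ => x) Q) (x : ℝ) :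
    ∫ t in Iic x, (cdf P t - cdf Q t) = (lowerMoment P x).toReal - (lowerMoment Q x).toReal := by
  rw [integral_sub (integrableOn_cdf hP x).1 (integrableOn_cdf hQ x).1, (integrableOn_cdf hP x).2,
    (integrableOn_cdf hQ x).2]

/-- Distribution functions are not integrable at +∞, so on the right half-line the difference is
written with the tails 1 - cdf, whose integrals are upper moments. -/
lemma integrable_cdf_sub_cdf (hP : Integrable (fun x : ℝ => x) P)
    (hQ : Integrable (fun x : ℝ => x) Q) :
    Integrable (fun t => cdf P t - cdf Q t) ∧
      ∫ t, (cdf P t - cdf Q t) = ∫ y, y ∂Q - ∫ y, y ∂P := by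
  have e : (fun t => cdf P t - cdf Q t) = fun t => (1 - cdf Q t) - (1 - cdf P t) := by
    ext t; ring
  have h1 : IntegrableOn (fun t => cdf P t - cdf Q t) (Iic 0) :=
    (integrableOn_cdf hP 0).1.sub (integrableOn_cdf hQ 0).1
  have h2 : IntegrableOn (fun t => cdf P t - cdf Q t) (Ioi 0) := by
    rw [e]
    exact (integrableOn_one_sub_cdf hQ 0).1.sub (integrableOn_one_sub_cdf hP 0).1
  have h : Integrable (fun t => cdf P t - cdf Q t) := by
    rw [← integrableOn_univ, ← Iic_union_Ioi (a := (0 : ℝ))]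
    exact h1.union h2
  refine ⟨h, ?_⟩
  have h3 : ∫ t in Ioi 0, (cdf P t - cdf Q t) =
      (upperMoment Q 0).toReal - (upperMoment P 0).toReal := by
    rw [e, integral_sub (integrableOn_one_sub_cdf hQ 0).1 (integrableOn_one_sub_cdf hP 0).1,
      (integrableOn_one_sub_cdf hQ 0).2, (integrableOn_one_sub_cdf hP 0).2]
  rw [← intervalIntegral.integral_Iic_add_Ioi h1 h2, h3, setIntegral_Iic_cdf_sub_cdf hP hQ]
  have := upperMoment_sub_lowerMoment hP 0
  have := upperMoment_sub_lowerMoment hQ 0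
  linarith

end CdfIntegrals

/-! ### Positivity and linear growth of g, and the resulting integrability. -/

section Growth

lemma ennreal_rpow_le_rpow_of_nonpos {x y : ℝ≥0∞} {z : ℝ} (hz : z ≤ 0) (h : x ≤ y) :
    y ^ z ≤ x ^ z := by
  rw [← neg_neg z, ENNReal.rpow_neg y, ENNReal.rpow_neg x]
  exact ENNReal.inv_le_inv.2 (ENNReal.rpow_le_rpow h (by linarith))

variable {g : ℝ → ℝ≥0∞} {r : ℝ}

/-- At a zero x, convexity bounds g by ε on a segment of length proportional to ε. Markov's
inequality then bounds a multiple of ε^(1 + r) by the finite integral for every small ε, which is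
absurd because 1 + r < 0. -/
lemma IsCoerciveClosedConvex.ne_zero (hg : IsCoerciveClosedConvex g) (hr : r < -1)
    (hf : ∫⁻ x, g x ^ r ≠ ∞) (x : ℝ) : g x ≠ 0 := by
  intro hx
  obtain ⟨z, hz, hzx⟩ : ∃ z, g z < ∞ ∧ z ≠ x := by
    obtain ⟨z, hz⟩ := hg.interior_dom_nonempty
    by_cases h : z = x
    · obtain ⟨δ, ⟨h1, -⟩, hδ⟩ :=
        ((IsCurvature.eventually_add_sub_mem hz).and self_mem_nhdsWithin).exists
      have hδ' : 0 < δ := hδ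
      exact ⟨z + δ, lt_top_of_mem_domInt h1, by rw [← h]; linarith⟩
    · exact ⟨z, lt_top_of_mem_domInt hz, h⟩
  set v := (g z).toReal + 1 with hv
  have hv1 : 1 ≤ v := by
    have : 0 ≤ (g z).toReal := ENNReal.toReal_nonneg
    linarith
  have hgz : g z ≤ ENNReal.ofReal v := by
    rw [← ENNReal.ofReal_toReal hz.ne]
    exact ENNReal.ofReal_le_ofReal (by linarith)
  have hd : 0 < |z - x| := abs_pos.2 (sub_ne_zero.2 hzx)
  set M := (∫⁻ x, g x ^ r).toReal with hM
  have key : ∀ ε : ℝ, 0 < ε → ε < 1 → ε ^ (1 + r) * (|z - x| / v) ≤ M := by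
    intro ε h0 h1
    have hmeas : Measurable fun x => g x ^ r := hg.measurable.pow_const r
    have hsub : uIcc x (x + ε / v * (z - x)) ⊆ {y | ENNReal.ofReal (ε ^ r) ≤ g y ^ r} := by
      intro y hy
      obtain ⟨θ, hθ0, hθ1, rfl⟩ : ∃ θ, 0 ≤ θ ∧ θ ≤ ε / v ∧ y = x + θ * (z - x) := by
        rw [← segment_eq_uIcc, segment_eq_image'] at hy
        obtain ⟨α, hα, rfl⟩ := hy
        refine ⟨α * (ε / v), mul_nonneg hα.1 (by positivity),
          mul_le_of_le_one_left (by positivity) hα.2, ?_⟩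
        simp only [smul_eq_mul]; ring
      have hθ2 : θ ≤ 1 := hθ1.trans ((div_le_one (by linarith)).2 (by linarith))
      have h := hg.convex.ennreal_le (sub_nonneg.2 hθ2) hθ0 (by ring) x z
      rw [hx, mul_zero, zero_add, show (1 - θ) * x + θ * z = x + θ * (z - x) by ring] at h
      have h3 : g (x + θ * (z - x)) ≤ ENNReal.ofReal ε := by
        refine h.trans ((mul_le_mul_right hgz _).trans ?_)
        rw [← ENNReal.ofReal_mul hθ0]
        refine ENNReal.ofReal_le_ofReal ?_
        rwa [le_div_iff₀ (by linarith)] at hθ1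
      have := ennreal_rpow_le_rpow_of_nonpos (z := r) (by linarith) h3
      rwa [ENNReal.ofReal_rpow_of_pos h0] at this
    have h2 := (mul_le_mul_right (measure_mono (μ := volume) hsub) (ENNReal.ofReal (ε ^ r))).trans
      (mul_meas_ge_le_lintegral hmeas _)
    rw [Real.volume_interval, add_sub_cancel_left, abs_mul, abs_of_nonneg (by positivity : 0 ≤ ε / v),
      ← ENNReal.ofReal_mul (by positivity), ENNReal.ofReal_le_iff_le_toReal hf] at h2
    refine le_trans (le_of_eq ?_) h2
    rw [Real.rpow_add h0, Real.rpow_one]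
    ring
  have hlim : Tendsto (fun ε : ℝ => ε ^ (1 + r) * (|z - x| / v)) (𝓝[>] 0) atTop :=
    (tendsto_rpow_neg_nhdsGT_zero (by linarith)).atTop_mul_const (by positivity)
  obtain ⟨ε, h1, h2⟩ := ((hlim.eventually_gt_atTop M).and (Ioo_mem_nhdsGT one_pos)).exists
  exact absurd (key ε h2.1 h2.2) (not_le.2 h1)

/-- A coercive convex function on the line grows at least linearly. -/
lemma IsCoerciveClosedConvex.exists_linear_growth (hg : IsCoerciveClosedConvex g)
    (h0 : ∀ x, g x ≠ 0) : ∃ η > 0, ∀ x, ENNReal.ofReal (η * (1 + |x|)) ≤ g x := by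
  obtain ⟨x₀, hx₀⟩ := hg.interior_dom_nonempty
  have hfin := lt_top_of_mem_domInt hx₀
  set v := (g x₀).toReal with hv
  have hv0 : 0 ≤ v := ENNReal.toReal_nonneg
  have hev : ∀ᶠ x in cocompact ℝ, ENNReal.ofReal (v + 1) < g x :=
    hg.coercive.eventually (lt_mem_nhds ENNReal.ofReal_lt_top)
  rw [← Metric.cobounded_eq_cocompact,
    (Metric.hasBasis_cobounded_compl_closedBall x₀).eventually_iff] at hev
  obtain ⟨R₀, -, hR₀⟩ := hev
  obtain ⟨R, hR1, hR⟩ : ∃ R : ℝ, 1 ≤ R ∧ ∀ x, R ≤ |x - x₀| → ENNReal.ofReal (v + 1) ≤ g x := by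
    refine ⟨max 1 (R₀ + 1), le_max_left _ _, fun x hx => (hR₀ ?_).le⟩
    rw [mem_compl_iff, Metric.mem_closedBall, Real.dist_eq, not_le]
    linarith [le_max_right 1 (R₀ + 1)]
  obtain ⟨m, hm0, hm⟩ : ∃ m : ℝ, 0 < m ∧ ∀ x ∈ Icc (x₀ - R) (x₀ + R), ENNReal.ofReal m ≤ g x := by
    obtain ⟨a, -, ha⟩ := (hg.closed.lowerSemicontinuousOn (Icc (x₀ - R) (x₀ + R))).exists_isMinOn
      ⟨x₀, by constructor <;> linarith⟩ isCompact_Icc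
    have hmin : min (g a) 1 ≠ ∞ := by simp
    refine ⟨(min (g a) 1).toReal, ENNReal.toReal_pos ?_ hmin, fun x hx => ?_⟩
    · rw [← pos_iff_ne_zero]
      exact lt_min (pos_iff_ne_zero.2 (h0 a)) one_pos
    · rw [ENNReal.ofReal_toReal hmin]
      exact (min_le_left _ _).trans (ha hx)
  -- The first entry serves |x - x₀| ≤ R, where g ≥ m and 1 + |x| ≤ 1 + |x₀| + R. The second serves
  -- D = |x - x₀| ≥ R ≥ 1, where 1 + |x| ≤ D(2 + |x₀|) and g x ≥ D / R.
  set η := min (m / (1 + |x₀| + R)) (1 / (R * (2 + |x₀|))) with hη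
  have hax := abs_nonneg x₀
  have hη0 : 0 < η := lt_min (by positivity) (by positivity)
  refine ⟨η, hη0, fun x => ?_⟩
  have htri : |x| ≤ |x₀| + |x - x₀| := by
    have := abs_add_le x₀ (x - x₀)
    rwa [add_sub_cancel] at this
  set D := |x - x₀| with hD
  rcases le_total D R with hDR | hDR
  · have hmem : x ∈ Icc (x₀ - R) (x₀ + R) := by
      rw [hD, abs_le] at hDR
      constructor <;> linarith [hDR.1, hDR.2]
    refine (ENNReal.ofReal_le_ofReal ?_).trans (hm x hmem)
    calc η * (1 + |x|) ≤ m / (1 + |x₀| + R) * (1 + |x₀| + R) := by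
          refine mul_le_mul (min_le_left _ _) (by linarith) (by positivity) (by positivity)
      _ = m := by field_simp
  · by_cases hgx : g x = ∞
    · rw [hgx]; exact le_top
    have hD1 : 1 ≤ D := hR1.trans hDR
    have hθ1 : R / D ≤ 1 := (div_le_one (by linarith)).2 hDR
    have hθ0 : 0 ≤ R / D := by positivity
    have h := hg.convex.ennreal_le (sub_nonneg.2 hθ1) hθ0 (by ring) x₀ x
    -- The point at distance R from x₀ towards x has value at least g(x₀) + 1; convexity propagates
    -- this unit increase over distance R linearly out to x.
    have hz : ENNReal.ofReal (v + 1) ≤ g ((1 - R / D) * x₀ + R / D * x) := by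
      refine hR _ (le_of_eq ?_)
      rw [show (1 - R / D) * x₀ + R / D * x - x₀ = R / D * (x - x₀) by ring, abs_mul, ← hD,
        abs_of_nonneg hθ0]
      field_simp
    have h2 := hz.trans h
    rw [← ENNReal.ofReal_toReal hfin.ne, ← ENNReal.ofReal_toReal hgx, ← hv,
      ← ENNReal.ofReal_mul (sub_nonneg.2 hθ1), ← ENNReal.ofReal_mul hθ0,
      ← ENNReal.ofReal_add (mul_nonneg (sub_nonneg.2 hθ1) hv0)
        (mul_nonneg hθ0 ENNReal.toReal_nonneg),
      ENNReal.ofReal_le_ofReal_iff (add_nonneg (mul_nonneg (sub_nonneg.2 hθ1) hv0)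
        (mul_nonneg hθ0 ENNReal.toReal_nonneg))] at h2
    have h3 : D / R ≤ (g x).toReal := by
      have h4 : 1 ≤ R / D * ((g x).toReal - v) := by nlinarith
      rw [div_mul_eq_mul_div, le_div_iff₀ (by linarith)] at h4
      rw [div_le_iff₀ (by linarith)]
      nlinarith
    rw [← ENNReal.ofReal_toReal hgx]
    refine ENNReal.ofReal_le_ofReal (le_trans ?_ h3)
    calc η * (1 + |x|) ≤ 1 / (R * (2 + |x₀|)) * (D * (2 + |x₀|)) := by
          gcongr
          · exact min_le_right _ _
          · nlinarith
      _ = D / R := by field_simp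

lemma lintegral_ofReal_rpow_lt_top {η : ℝ} (hη : 0 < η) (hr : r < -1) :
    ∫⁻ x : ℝ, ENNReal.ofReal (η * (1 + |x|)) ^ r < ∞ := by
  have h := finite_integral_one_add_norm (E := ℝ) (r := -r) (μ := volume)
    (by simp; linarith)
  have : ∀ x : ℝ, ENNReal.ofReal (η * (1 + |x|)) ^ r =
      ENNReal.ofReal (η ^ r) * ENNReal.ofReal ((1 + ‖x‖) ^ (-(-r))) := by
    intro x
    rw [ENNReal.ofReal_rpow_of_pos (by positivity), Real.mul_rpow hη.le (by positivity),
      ENNReal.ofReal_mul (by positivity), neg_neg, Real.norm_eq_abs]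
  simp_rw [this]
  rw [lintegral_const_mul _ (by fun_prop)]
  exact ENNReal.mul_lt_top ENNReal.ofReal_lt_top h

/-- The linear factor raises the exponent to 1 + r, which is below -1 because r < -2. -/
lemma lintegral_ofReal_mul_rpow_lt_top {η : ℝ} (hη : 0 < η) (hr : r < -2) {C : ℝ} (hC : 0 ≤ C) :
    ∫⁻ x : ℝ, ENNReal.ofReal (C * (1 + |x|)) * ENNReal.ofReal (η * (1 + |x|)) ^ r < ∞ := by
  have h := lintegral_ofReal_rpow_lt_top (r := 1 + r) hη (by linarith)
  have : ∀ x : ℝ, ENNReal.ofReal (C * (1 + |x|)) * ENNReal.ofReal (η * (1 + |x|)) ^ r =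
      ENNReal.ofReal (C / η) * ENNReal.ofReal (η * (1 + |x|)) ^ (1 + r) := by
    intro x
    have hpos : 0 < η * (1 + |x|) := by positivity
    rw [ENNReal.rpow_add _ _ (ENNReal.ofReal_pos.2 hpos).ne' ENNReal.ofReal_ne_top,
      ENNReal.rpow_one, ← mul_assoc, ← ENNReal.ofReal_mul (by positivity)]
    congr 2
    field_simp
  simp_rw [this]
  rw [lintegral_const_mul _ (by fun_prop)]
  exact ENNReal.mul_lt_top ENNReal.ofReal_lt_top h

end Growth

/-! ### The tangent inequality for the power y^β. -/

section Tangent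

/-- Dividing by a · a^r leaves Bernoulli's inequality for u = y / a with negative exponent, which
follows from log u ≤ u - 1 and e^z ≥ 1 + z. -/
lemma rpow_tangent_real {r a y : ℝ} (hr : 1 + r < 0) (ha : 0 < a) (hy : 0 < y) :
    a * a ^ r + 1 / |1 + r| * a ^ (1 + r) ≤ y * a ^ r + 1 / |1 + r| * y ^ (1 + r) := by
  have hu : 0 < y / a := by positivity
  have h1 : 1 + (1 + r) * (y / a - 1) ≤ (y / a) ^ (1 + r) := by
    have h2 : Real.log (y / a) ≤ y / a - 1 := Real.log_le_sub_one_of_pos hu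
    have h3 := Real.add_one_le_exp (Real.log (y / a) * (1 + r))
    rw [← Real.rpow_def_of_pos hu] at h3
    nlinarith
  have h4 : y ^ (1 + r) = (y / a) ^ (1 + r) * (a * a ^ r) := by
    rw [← Real.rpow_one_add' ha.le hr.ne, ← Real.mul_rpow hu.le ha.le, div_mul_cancel₀ _ ha.ne']
  have h5 : 0 < a * a ^ r := by positivity
  rw [h4, Real.rpow_one_add' ha.le hr.ne, abs_of_neg hr]
  have hb : 0 < -(1 + r) := by linarith
  have h6 : y * a ^ r = y / a * (a * a ^ r) := by field_simp
  rw [h6]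
  have h7 : 1 + 1 / -(1 + r) ≤ y / a + 1 / -(1 + r) * (y / a) ^ (1 + r) := by
    have h8 : 1 / -(1 + r) * (1 + (1 + r) * (y / a - 1)) ≤
        1 / -(1 + r) * (y / a) ^ (1 + r) := by gcongr
    have h9 : 1 / -(1 + r) * (1 + (1 + r) * (y / a - 1)) = 1 / -(1 + r) - (y / a - 1) := by
      have hb' : 1 / -(1 + r) * (1 + r) = -1 := by
        rw [one_div, inv_neg, neg_mul, inv_mul_cancel₀ hr.ne]
      linear_combination (y / a - 1) * hb'
    linarith
  nlinarith

/-- The tangent inequality of the convex function `y ↦ y ^ (1 + r) / |1 + r|`. -/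
lemma rpow_tangent {r : ℝ} (hr : 1 + r < 0) {a : ℝ≥0∞} (ha : a ≠ 0) (y : ℝ≥0∞) :
    a * a ^ r + ENNReal.ofReal (1 / |1 + r|) * a ^ (1 + r) ≤
      y * a ^ r + ENNReal.ofReal (1 / |1 + r|) * y ^ (1 + r) := by
  have hb : ENNReal.ofReal (1 / |1 + r|) ≠ 0 :=
    (ENNReal.ofReal_pos.2 (one_div_pos.2 (abs_pos.2 hr.ne))).ne'
  by_cases hat : a = ∞
  · rw [hat, ENNReal.top_rpow_of_neg (by linarith), ENNReal.top_rpow_of_neg hr]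
    simp
  by_cases hyt : y = ∞
  · rw [hyt, ENNReal.top_mul, top_add]
    · exact le_top
    · simp [ENNReal.rpow_eq_zero_iff, ha, hat]
  by_cases hy0 : y = 0
  · rw [hy0, ENNReal.zero_rpow_of_neg hr, ENNReal.mul_top hb, add_top]
    exact le_top
  have hap := ENNReal.toReal_pos ha hat
  have hyp := ENNReal.toReal_pos hy0 hyt
  rw [← ENNReal.ofReal_toReal hat, ← ENNReal.ofReal_toReal hyt]
  rw [ENNReal.ofReal_rpow_of_pos hap, ENNReal.ofReal_rpow_of_pos hap,
    ENNReal.ofReal_rpow_of_pos hyp, ← ENNReal.ofReal_mul hap.le, ← ENNReal.ofReal_mul hyp.le,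
    ← ENNReal.ofReal_mul (by positivity), ← ENNReal.ofReal_mul (by positivity),
    ← ENNReal.ofReal_add (by positivity) (by positivity),
    ← ENNReal.ofReal_add (by positivity) (by positivity)]
  exact ENNReal.ofReal_le_ofReal (rpow_tangent_real hr hap hyp)

end Tangent

/-! ### Admissible competitors and perturbations. -/

lemma isCoerciveClosedConvex_of_growth {h : ℝ → ℝ≥0∞} (hconv : ConvexOn ℝ≥0 univ h)
    (hlsc : LowerSemicontinuous h) (hdom : (interior {x | h x < ∞}).Nonempty) {η : ℝ} (hη : 0 < η)
    (hgrow : ∀ x, ENNReal.ofReal (η * (1 + |x|)) ≤ h x) : IsCoerciveClosedConvex h := by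
  refine ⟨hconv, hlsc, hdom, tendsto_nhds_top_mono ?_ (Eventually.of_forall hgrow)⟩
  refine ENNReal.tendsto_ofReal_atTop.comp (Tendsto.const_mul_atTop hη ?_)
  exact tendsto_atTop_add_const_left _ _ tendsto_norm_cocompact_atTop

lemma isCoerciveClosedConvex_one_add_abs :
    IsCoerciveClosedConvex fun x : ℝ => ENNReal.ofReal (1 + |x|) := by
  refine isCoerciveClosedConvex_of_growth (η := 1) (convexOn_ofReal ?_) ?_ ?_ one_pos fun x => ?_
  · refine ConvexOn.add (convexOn_const _ convex_univ) ?_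
    exact convexOn_univ_norm
  · exact Continuous.lowerSemicontinuous (ENNReal.continuous_ofReal.comp (by fun_prop))
  · simp
  · rw [one_mul]

/-- The function `g + ε (p - n)`. -/
noncomputable def perturb (g : ℝ → ℝ≥0∞) (p n : ℝ → ℝ) (ε : ℝ) (x : ℝ) : ℝ≥0∞ :=
  g x + ENNReal.ofReal (ε * p x) - ENNReal.ofReal (ε * n x)

section Perturb

variable {g : ℝ → ℝ≥0∞} {p n : ℝ → ℝ} {η C ε : ℝ}

/-- Half of the linear growth of g absorbs ε n and the other half remains. Hence the truncated
subtraction in `perturb` loses nothing and the perturbation is still coercive. -/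
lemma ofReal_le_of_growth (hgrow : ∀ x, ENNReal.ofReal (η * (1 + |x|)) ≤ g x) (hε : 0 ≤ ε)
    (hnC : ∀ x, n x ≤ C * (1 + |x|)) (hεC : ε * C ≤ η / 2) (x : ℝ) :
    ENNReal.ofReal (η / 2 * (1 + |x|)) + ENNReal.ofReal (ε * n x) ≤ g x := by
  refine le_trans ?_ (hgrow x)
  have h1 : ε * n x ≤ η / 2 * (1 + |x|) := by
    calc ε * n x ≤ ε * (C * (1 + |x|)) := mul_le_mul_of_nonneg_left (hnC x) hε
      _ = ε * C * (1 + |x|) := by ring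
      _ ≤ _ := mul_le_mul_of_nonneg_right hεC (by positivity)
  by_cases hη : 0 ≤ η
  · calc _ ≤ ENNReal.ofReal (η / 2 * (1 + |x|)) + ENNReal.ofReal (η / 2 * (1 + |x|)) := by gcongr
      _ = _ := by
        rw [← ENNReal.ofReal_add (by positivity) (by positivity)]
        congr 1; ring
  · have h2 : η / 2 * (1 + |x|) ≤ 0 :=
      mul_nonpos_of_nonpos_of_nonneg (by linarith) (by positivity)
    rw [ENNReal.ofReal_of_nonpos h2, ENNReal.ofReal_of_nonpos (h1.trans h2), add_zero]
    exact zero_le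

lemma perturb_add (hgrow : ∀ x, ENNReal.ofReal (η * (1 + |x|)) ≤ g x) (hε : 0 ≤ ε)
    (hnC : ∀ x, n x ≤ C * (1 + |x|)) (hεC : ε * C ≤ η / 2) (x : ℝ) :
    perturb g p n ε x + ENNReal.ofReal (ε * n x) = g x + ENNReal.ofReal (ε * p x) :=
  tsub_add_cancel_of_le
    ((le_add_self.trans (ofReal_le_of_growth hgrow hε hnC hεC x)).trans le_self_add)

lemma perturb_growth (hgrow : ∀ x, ENNReal.ofReal (η * (1 + |x|)) ≤ g x) (hε : 0 ≤ ε)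
    (hnC : ∀ x, n x ≤ C * (1 + |x|)) (hεC : ε * C ≤ η / 2) (x : ℝ) :
    ENNReal.ofReal (η / 2 * (1 + |x|)) ≤ perturb g p n ε x :=
  ENNReal.le_sub_of_add_le_right ENNReal.ofReal_ne_top
    ((ofReal_le_of_growth hgrow hε hnC hεC x).trans le_self_add)

lemma lowerSemicontinuous_perturb (hg : LowerSemicontinuous g) (hp : Continuous p)
    (hn : Continuous n) (ε : ℝ) : LowerSemicontinuous (perturb g p n ε) := by
  intro x c hc
  have hl : LowerSemicontinuous fun x => g x + ENNReal.ofReal (ε * p x) :=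
    hg.add (Continuous.lowerSemicontinuous (ENNReal.continuous_ofReal.comp (by fun_prop)))
  rw [gt_iff_lt, perturb, lt_tsub_iff_right] at hc
  obtain ⟨d, hd1, hd2⟩ := exists_between hc
  have hcont : ContinuousAt (fun y => c + ENNReal.ofReal (ε * n y)) x :=
    (continuous_const.add (ENNReal.continuous_ofReal.comp (by fun_prop))).continuousAt
  filter_upwards [hl x d hd2, hcont.eventually (gt_mem_nhds hd1)] with y h1 h2
  rw [gt_iff_lt, perturb, lt_tsub_iff_right]
  exact h2.trans h1

lemma isCoerciveClosedConvex_perturb (hg : IsCoerciveClosedConvex g) (hη : 0 < η)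
    (hgrow : ∀ x, ENNReal.ofReal (η * (1 + |x|)) ≤ g x) (hp : Continuous p) (hn : Continuous n)
    (hnC : ∀ x, n x ≤ C * (1 + |x|)) (hε : 0 ≤ ε) (hεC : ε * C ≤ η / 2)
    (hconv : ConvexOn ℝ≥0 univ (perturb g p n ε)) : IsCoerciveClosedConvex (perturb g p n ε) := by
  refine isCoerciveClosedConvex_of_growth hconv (lowerSemicontinuous_perturb hg.closed hp hn ε) ?_
    (half_pos hη) (perturb_growth hgrow hε hnC hεC)
  refine hg.interior_dom_nonempty.mono (interior_mono fun x hx => ?_)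
  have hx' : g x < ∞ := hx
  refine lt_of_le_of_lt tsub_le_self (?_ : g x + ENNReal.ofReal (ε * p x) < ∞)
  exact ENNReal.add_lt_top.2 ⟨hx', ENNReal.ofReal_lt_top⟩

lemma tendsto_perturb (g : ℝ → ℝ≥0∞) (p n : ℝ → ℝ) (x : ℝ) :
    Tendsto (fun ε => perturb g p n ε x) (𝓝[>] 0) (𝓝 (g x)) := by
  by_cases hx : g x = ∞
  · have : (fun ε => perturb g p n ε x) = fun _ => g x := by
      ext ε
      simp [perturb, hx]
    rw [this]
    exact tendsto_const_nhds
  · have h1 : ∀ u : ℝ, Tendsto (fun ε : ℝ => ENNReal.ofReal (ε * u)) (𝓝[>] 0) (𝓝 0) := by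
      intro u
      have : Continuous fun ε : ℝ => ENNReal.ofReal (ε * u) :=
        ENNReal.continuous_ofReal.comp (by fun_prop)
      have h := this.tendsto 0
      simp only [zero_mul, ENNReal.ofReal_zero] at h
      exact h.mono_left nhdsWithin_le_nhds
    have h2 := ENNReal.Tendsto.sub ((tendsto_const_nhds (x := g x)).add (h1 (p x))) (h1 (n x))
      (Or.inl (by simpa using hx))
    simpa [perturb] using h2

end Perturb

/-! ### First-order conditions for a minimizer. -/

section FirstOrder

variable {s : ℝ} {Q : Measure ℝ} {g : ℝ → ℝ≥0∞}

lemma one_div_lt_neg_two (hs : -1 / 2 < s) (hs0 : s < 0) : 1 / s < -2 := by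
  rw [div_lt_iff_of_neg hs0]
  linarith

lemma lintegral_rpow_lt_top_of_growth {h : ℝ → ℝ≥0∞} {η r : ℝ} (hη : 0 < η) (hr : r < -1)
    (hgrow : ∀ x, ENNReal.ofReal (η * (1 + |x|)) ≤ h x) : ∫⁻ x, h x ^ r < ∞ :=
  (lintegral_mono fun x => ennreal_rpow_le_rpow_of_nonpos (by linarith) (hgrow x)).trans_lt
    (lintegral_ofReal_rpow_lt_top hη hr)

lemma lintegral_mul_rpow_lt_top_of_growth {h : ℝ → ℝ≥0∞} {η r C : ℝ} {u : ℝ → ℝ} (hη : 0 < η)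
    (hr : r < -2) (hC : 0 ≤ C) (hu : ∀ x, u x ≤ C * (1 + |x|))
    (hgrow : ∀ x, ENNReal.ofReal (η * (1 + |x|)) ≤ h x) :
    ∫⁻ x, ENNReal.ofReal (u x) * h x ^ r < ∞ :=
  (lintegral_mono fun x => mul_le_mul' (ENNReal.ofReal_le_ofReal (hu x))
    (ennreal_rpow_le_rpow_of_nonpos (by linarith) (hgrow x))).trans_lt
    (lintegral_ofReal_mul_rpow_lt_top hη hr hC)

lemma mul_rpow_self {a : ℝ≥0∞} {r : ℝ} (hr : 1 + r < 0) (ha : a ≠ 0) : a * a ^ r = a ^ (1 + r) := by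
  by_cases hat : a = ∞
  · rw [hat, ENNReal.top_rpow_of_neg (by linarith), ENNReal.top_rpow_of_neg hr, mul_zero]
  · rw [ENNReal.rpow_add _ _ ha hat, ENNReal.rpow_one]

lemma lintegral_ofReal_lt_top_of_linear [IsProbabilityMeasure Q]
    (hQ : Integrable (fun x : ℝ => x) Q) {u : ℝ → ℝ} {C : ℝ} (hu : ∀ x, u x ≤ C * (1 + |x|)) :
    ∫⁻ x, ENNReal.ofReal (u x) ∂Q < ∞ := by
  refine (lintegral_mono fun x => ENNReal.ofReal_le_ofReal (hu x)).trans_lt ?_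
  exact (((integrable_const 1).add hQ.abs).const_mul C).lintegral_lt_top

/-- The competitor 1 + |x| has a finite functional value. -/
lemma IsRenyiProjection.lintegral_lt_top (hs : -1 / 2 < s) (hs0 : s < 0) [IsProbabilityMeasure Q]
    (hQ : Integrable (fun x : ℝ => x) Q) (hmin : IsRenyiProjection s Q g) :
    ∫⁻ x, g x ∂Q < ∞ := by
  have hr := one_div_lt_neg_two hs hs0
  have h := hmin.2 _ isCoerciveClosedConvex_one_add_abs
  refine (le_self_add.trans h).trans_lt ?_
  refine ENNReal.add_lt_top.2 ⟨?_, ENNReal.mul_lt_top ENNReal.ofReal_lt_top ?_⟩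
  · exact lintegral_ofReal_lt_top_of_linear hQ (C := 1) fun x => by rw [one_mul]
  · exact lintegral_rpow_lt_top_of_growth (η := 1) one_pos (by linarith) fun x => by rw [one_mul]

variable {p n : ℝ → ℝ} {η C ε : ℝ}

/-- The tangent inequality is taken at the perturbed function h rather than at g and combined with
minimality of g; the power integrals cancel, and dividing by ε leaves the first-order condition with
h^(1/s) as weight. No differentiation under the integral is needed, only the limit ε → 0. -/
lemma IsRenyiProjection.perturb_le (hs : -1 / 2 < s) (hs0 : s < 0) [IsProbabilityMeasure Q]
    (hQ : Integrable (fun x : ℝ => x) Q) (hmin : IsRenyiProjection s Q g) (hη : 0 < η)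
    (hgrow : ∀ x, ENNReal.ofReal (η * (1 + |x|)) ≤ g x) (hp : Continuous p) (hn : Continuous n)
    (hC : 0 ≤ C) (hnC : ∀ x, n x ≤ C * (1 + |x|)) (hε : 0 < ε) (hεC : ε * C ≤ η / 2)
    (hconv : ConvexOn ℝ≥0 univ (perturb g p n ε)) :
    (∫⁻ x, ENNReal.ofReal (p x) * perturb g p n ε x ^ (1 / s)) + ∫⁻ x, ENNReal.ofReal (n x) ∂Q ≤
      (∫⁻ x, ENNReal.ofReal (n x) * perturb g p n ε x ^ (1 / s)) +
        ∫⁻ x, ENNReal.ofReal (p x) ∂Q := by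
  have hr := one_div_lt_neg_two hs hs0
  have hb : 1 + 1 / s < 0 := by linarith
  have hgm := hmin.1.measurable
  have hh := isCoerciveClosedConvex_perturb hmin.1 hη hgrow hp hn hnC hε.le hεC hconv
  have hhg := perturb_growth (p := p) hgrow hε.le hnC hεC
  have hadd := perturb_add (p := p) hgrow hε.le hnC hεC
  set h := perturb g p n ε with hdef
  set r := 1 / s with hrdef
  have hhm := hh.measurable
  have hhr : Measurable fun x => h x ^ r := hhm.pow_const r
  have hη2 : 0 < η / 2 := half_pos hη
  have hne : ∀ x, h x ≠ 0 := fun x => by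
    refine ((ENNReal.ofReal_pos.2 ?_).trans_le (hhg x)).ne'
    positivity
  set k := ENNReal.ofReal (1 / |1 + r|) with hk
  have e1 : (∫⁻ x, h x * h x ^ r) + k * ∫⁻ x, h x ^ (1 + r) ≤
      (∫⁻ x, g x * h x ^ r) + k * ∫⁻ x, g x ^ (1 + r) := by
    rw [← lintegral_const_mul _ (hhm.pow_const _), ← lintegral_const_mul _ (hgm.pow_const _),
      ← lintegral_add_left (by fun_prop), ← lintegral_add_left (by fun_prop)]
    exact lintegral_mono fun x => rpow_tangent hb (hne x) (g x)
  have e2 : ∫⁻ x, g x ∂Q + k * ∫⁻ x, g x ^ (1 + r) ≤ ∫⁻ x, h x ∂Q + k * ∫⁻ x, h x ^ (1 + r) :=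
    hmin.2 h hh
  have hsplit : ∀ u : ℝ → ℝ, ∫⁻ x, ENNReal.ofReal (ε * u x) * h x ^ r =
      ENNReal.ofReal ε * ∫⁻ x, ENNReal.ofReal (u x) * h x ^ r := fun u => by
    rw [← lintegral_const_mul' _ _ ENNReal.ofReal_ne_top]
    simp_rw [ENNReal.ofReal_mul hε.le, mul_assoc]
  have hsplitQ : ∀ u : ℝ → ℝ, ∫⁻ x, ENNReal.ofReal (ε * u x) ∂Q =
      ENNReal.ofReal ε * ∫⁻ x, ENNReal.ofReal (u x) ∂Q := fun u => by
    rw [← lintegral_const_mul' _ _ ENNReal.ofReal_ne_top]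
    simp_rw [ENNReal.ofReal_mul hε.le]
  have e3 : (∫⁻ x, h x * h x ^ r) + ENNReal.ofReal ε * ∫⁻ x, ENNReal.ofReal (n x) * h x ^ r =
      (∫⁻ x, g x * h x ^ r) + ENNReal.ofReal ε * ∫⁻ x, ENNReal.ofReal (p x) * h x ^ r := by
    rw [← hsplit, ← hsplit, ← lintegral_add_left (by fun_prop), ← lintegral_add_left (by fun_prop)]
    refine lintegral_congr fun x => ?_
    rw [← add_mul, ← add_mul, hadd]
  have e4 : ∫⁻ x, h x ∂Q + ENNReal.ofReal ε * ∫⁻ x, ENNReal.ofReal (n x) ∂Q =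
      ∫⁻ x, g x ∂Q + ENNReal.ofReal ε * ∫⁻ x, ENNReal.ofReal (p x) ∂Q := by
    rw [← hsplitQ, ← hsplitQ, ← lintegral_add_left hhm, ← lintegral_add_left hgm]
    exact lintegral_congr fun x => hadd x
  have fXh : ∫⁻ x, h x * h x ^ r < ∞ := by
    rw [lintegral_congr fun x => mul_rpow_self hb (hne x)]
    exact lintegral_rpow_lt_top_of_growth hη2 (by linarith) hhg
  have fN : ∫⁻ x, ENNReal.ofReal (n x) * h x ^ r < ∞ :=
    lintegral_mul_rpow_lt_top_of_growth hη2 hr hC hnC hhg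
  have fXg : ∫⁻ x, g x * h x ^ r < ∞ := by
    refine lt_of_le_of_lt le_self_add (e3.symm.trans_lt ?_)
    finiteness
  have fG := hmin.lintegral_lt_top hs hs0 hQ
  have fBg : ∫⁻ x, g x ^ (1 + r) < ∞ := lintegral_rpow_lt_top_of_growth hη (by linarith) hgrow
  have fBh : ∫⁻ x, h x ^ (1 + r) < ∞ := lintegral_rpow_lt_top_of_growth hη2 (by linarith) hhg
  set Xh := ∫⁻ x, h x * h x ^ r
  set Xg := ∫⁻ x, g x * h x ^ r
  set Bh := ∫⁻ x, h x ^ (1 + r)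
  set Bg := ∫⁻ x, g x ^ (1 + r)
  set G := ∫⁻ x, g x ∂Q
  set D := ∫⁻ x, h x ∂Q
  set P' := ∫⁻ x, ENNReal.ofReal (p x) * h x ^ r
  set N' := ∫⁻ x, ENNReal.ofReal (n x) * h x ^ r
  set PQ := ∫⁻ x, ENNReal.ofReal (p x) ∂Q
  set NQ := ∫⁻ x, ENNReal.ofReal (n x) ∂Q
  set e := ENNReal.ofReal ε with he
  have he0 : e ≠ 0 := (ENNReal.ofReal_pos.2 hε).ne'
  have hetop : e ≠ ∞ := ENNReal.ofReal_ne_top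
  have hktop : k ≠ ∞ := ENNReal.ofReal_ne_top
  have e5 : Xh + G ≤ Xg + D := by
    have hf : k * Bh + k * Bg ≠ ∞ := by finiteness
    refine (ENNReal.add_le_add_iff_right hf).1 ?_
    calc Xh + G + (k * Bh + k * Bg) = (Xh + k * Bh) + (G + k * Bg) := by ring
      _ ≤ (Xg + k * Bg) + (D + k * Bh) := add_le_add e1 e2
      _ = _ := by ring
  refine (ENNReal.mul_le_mul_iff_right he0 hetop).1 ?_
  have hf : Xg + G ≠ ∞ := by finiteness
  refine (ENNReal.add_le_add_iff_right hf).1 ?_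
  calc e * (P' + NQ) + (Xg + G) = (Xg + e * P') + G + e * NQ := by ring
    _ = (Xh + G) + e * N' + e * NQ := by rw [← e3]; ring
    _ ≤ (Xg + D) + e * N' + e * NQ := by gcongr
    _ = (D + e * NQ) + Xg + e * N' := by ring
    _ = e * (N' + PQ) + (Xg + G) := by rw [e4]; ring

lemma tendsto_lintegral_mul_perturb_rpow {u : ℝ → ℝ} {r : ℝ} (hr : r < -2) (hgm : Measurable g)
    (hη : 0 < η) (hgrow : ∀ x, ENNReal.ofReal (η * (1 + |x|)) ≤ g x) (hp : Continuous p)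
    (hn : Continuous n) (hu : Continuous u) (hC : 0 ≤ C) (huC : ∀ x, u x ≤ C * (1 + |x|))
    (hnC : ∀ x, n x ≤ C * (1 + |x|)) :
    Tendsto (fun ε => ∫⁻ x, ENNReal.ofReal (u x) * perturb g p n ε x ^ r) (𝓝[>] 0)
      (𝓝 (∫⁻ x, ENNReal.ofReal (u x) * g x ^ r)) := by
  refine tendsto_lintegral_filter_of_dominated_convergence
    (fun x => ENNReal.ofReal (C * (1 + |x|)) * ENNReal.ofReal (η / 2 * (1 + |x|)) ^ r) ?_ ?_
    (lintegral_ofReal_mul_rpow_lt_top (half_pos hη) hr hC).ne ?_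
  · refine Eventually.of_forall fun ε => ?_
    unfold perturb
    fun_prop
  · have hlim : Tendsto (fun ε : ℝ => ε * C) (𝓝[>] 0) (𝓝 0) := by
      have h := (continuous_mul_const C).tendsto (0 : ℝ)
      rw [zero_mul] at h
      exact h.mono_left nhdsWithin_le_nhds
    filter_upwards [hlim.eventually (gt_mem_nhds (half_pos hη)), self_mem_nhdsWithin] with ε h1 h2
    refine ae_of_all _ fun x => mul_le_mul' (ENNReal.ofReal_le_ofReal (huC x)) ?_
    exact ennreal_rpow_le_rpow_of_nonpos (by linarith)
      (perturb_growth hgrow (le_of_lt h2) hnC h1.le x)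
  · refine ae_of_all _ fun x => ENNReal.Tendsto.const_mul ?_ (Or.inr ENNReal.ofReal_ne_top)
    exact (ENNReal.continuous_rpow_const.tendsto _).comp (tendsto_perturb g p n x)

/-- The first-order condition for a minimizer `g` in the admissible direction `p - n`. -/
theorem IsRenyiProjection.first_order (hs : -1 / 2 < s) (hs0 : s < 0) [IsProbabilityMeasure Q]
    (hQ : Integrable (fun x : ℝ => x) Q) (hmin : IsRenyiProjection s Q g) (hη : 0 < η)
    (hgrow : ∀ x, ENNReal.ofReal (η * (1 + |x|)) ≤ g x) (hp : Continuous p) (hn : Continuous n)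
    (hC : 0 ≤ C) (hpC : ∀ x, p x ≤ C * (1 + |x|)) (hnC : ∀ x, n x ≤ C * (1 + |x|))
    (hconv : ∀ ε, 0 < ε → ε * C ≤ η / 2 → ε < 1 → ConvexOn ℝ≥0 univ (perturb g p n ε)) :
    (∫⁻ x, ENNReal.ofReal (p x) * g x ^ (1 / s)) + ∫⁻ x, ENNReal.ofReal (n x) ∂Q ≤
      (∫⁻ x, ENNReal.ofReal (n x) * g x ^ (1 / s)) + ∫⁻ x, ENNReal.ofReal (p x) ∂Q := by
  have hr := one_div_lt_neg_two hs hs0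
  have hgm := hmin.1.measurable
  have hlim : Tendsto (fun ε : ℝ => ε * C) (𝓝[>] 0) (𝓝 0) := by
    have h := (continuous_mul_const C).tendsto (0 : ℝ)
    rw [zero_mul] at h
    exact h.mono_left nhdsWithin_le_nhds
  refine le_of_tendsto_of_tendsto
    ((tendsto_lintegral_mul_perturb_rpow hr hgm hη hgrow hp hn hp hC hpC hnC).add_const _)
    ((tendsto_lintegral_mul_perturb_rpow hr hgm hη hgrow hp hn hn hC hnC hnC).add_const _) ?_
  filter_upwards [hlim.eventually (gt_mem_nhds (half_pos hη)), Ioo_mem_nhdsGT one_pos]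
    with ε h1 h2
  exact hmin.perturb_le hs hs0 hQ hη hgrow hp hn hC hnC h2.1 h1.le
    (hconv ε h2.1 h1.le h2.2)

end FirstOrder

/-! ### The measure with density g^(1/s). -/

section PowerMeasure

variable {s : ℝ} {g : ℝ → ℝ≥0∞}

lemma lintegral_powerMeasure (hg : Measurable g) {h : ℝ → ℝ≥0∞} (hh : Measurable h) :
    ∫⁻ x, h x ∂(powerMeasure s g) = ∫⁻ x, h x * g x ^ (1 / s) := by
  rw [powerMeasure, lintegral_withDensity_eq_lintegral_mul _ (hg.pow_const _) hh]
  exact lintegral_congr fun x => mul_comm _ _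

lemma isProbabilityMeasure_powerMeasure (hf : ∫⁻ x, g x ^ (1 / s) = 1) :
    IsProbabilityMeasure (powerMeasure s g) :=
  ⟨by rw [powerMeasure, withDensity_apply _ MeasurableSet.univ, Measure.restrict_univ, hf]⟩

lemma integrable_powerMeasure (hs : -1 / 2 < s) (hs0 : s < 0) (hg : Measurable g) {η : ℝ}
    (hη : 0 < η) (hgrow : ∀ x, ENNReal.ofReal (η * (1 + |x|)) ≤ g x) :
    Integrable (fun x : ℝ => x) (powerMeasure s g) := by
  refine ⟨by fun_prop, ?_⟩
  rw [HasFiniteIntegral, lintegral_powerMeasure hg (by fun_prop)]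
  have h := lintegral_mul_rpow_lt_top_of_growth (u := fun x => |x|) hη (one_div_lt_neg_two hs hs0)
    zero_le_one (fun x => by linarith) hgrow
  simpa [Real.enorm_eq_ofReal_abs] using h

lemma ae_powerMeasure_mem_closure (hs0 : s < 0) (hg : IsCoerciveClosedConvex g) :
    ∀ᵐ y ∂(powerMeasure s g), y ∈ closure (domInt g) := by
  have hm : MeasurableSet (closure (domInt g))ᶜ := isClosed_closure.measurableSet.compl
  refine ae_iff.2 ?_
  change powerMeasure s g (closure (domInt g))ᶜ = 0
  rw [powerMeasure, withDensity_apply _ hm, setLIntegral_congr_fun hm (g := fun _ => 0)]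
  · simp
  · intro x hx
    simp only
    rw [hg.eq_top_of_notMem_closure hx, ENNReal.top_rpow_of_neg (one_div_neg.2 hs0)]

end PowerMeasure

/-! ### The moment conditions imply minimality. -/

section Sufficiency

variable {P Q : Measure ℝ} [IsProbabilityMeasure P] [IsProbabilityMeasure Q] {g : ℝ → ℝ≥0∞}

/-- Ordered partial moments and equal means imply the convex order. -/
theorem lintegral_le_of_moments_le (hP : Integrable (fun x : ℝ => x) P)
    (hQ : Integrable (fun x : ℝ => x) Q) (hm : ∫ y, y ∂P = ∫ y, y ∂Q)
    (hl : ∀ t, lowerMoment P t ≤ lowerMoment Q t) (hg : IsCoerciveClosedConvex g) :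
    ∫⁻ y, g y ∂P ≤ ∫⁻ y, g y ∂Q := by
  -- Taylor's formula holds only on the closure of the domain. If the right side is finite, Q is
  -- carried by that closure, and the moment inequalities pass this on to P.
  by_cases htop : ∫⁻ y, g y ∂Q = ∞
  · rw [htop]; exact le_top
  obtain ⟨μ, _, hμ⟩ := hg.exists_isCurvature
  have hQI : ∀ᵐ y ∂Q, y ∈ closure (domInt g) := by
    filter_upwards [ae_lt_top hg.measurable htop] with y hy
    by_contra h
    exact hy.ne (hg.eq_top_of_notMem_closure h)
  have hPI := ae_mem_of_moments_le isClosed_closure hg.convex_domInt.closure.ordConnected hl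
    (fun t => (upperMoment_le_iff hP hQ hm t).2 (hl t)) hQI
  exact hμ.lintegral_le hg hP hQ hm hPI hQI (ae_of_all _ hl)

lemma upperMoment_eq_of_lowerMoment_eq (hP : Integrable (fun x : ℝ => x) P)
    (hQ : Integrable (fun x : ℝ => x) Q) (hm : ∫ y, y ∂P = ∫ y, y ∂Q) {t : ℝ}
    (h : lowerMoment P t = lowerMoment Q t) : upperMoment P t = upperMoment Q t :=
  le_antisymm ((upperMoment_le_iff hP hQ hm t).2 h.le)
    ((upperMoment_le_iff hQ hP hm.symm t).2 h.ge)

lemma upperMoment_le_add (P : Measure ℝ) [IsProbabilityMeasure P] (t u : ℝ) :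
    upperMoment P t ≤ upperMoment P u + ENNReal.ofReal (u - t) := by
  have : ENNReal.ofReal (u - t) = ∫⁻ _, ENNReal.ofReal (u - t) ∂P := by simp
  rw [this, upperMoment, upperMoment, ← lintegral_add_left (by fun_prop)]
  refine lintegral_mono fun y => ?_
  refine le_trans (ENNReal.ofReal_le_ofReal (le_of_eq ?_)) ENNReal.ofReal_add_le
  ring

/-- If the remainder in Taylor's formula vanishes at a point of the closure of the domain, then `g`
is finite there. -/
lemma IsCurvature.lt_top_of_ae_kink_eq_zero {μ : Measure ℝ} (hμ : IsCurvature g μ) {c y : ℝ}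
    (hc : c ∈ domInt g) (hy : y ∈ closure (domInt g)) (h : ∀ᵐ t ∂μ, kink c y t = 0) :
    g y < ∞ := by
  obtain ⟨p, hp⟩ := hμ.2 c hc
  have e := hp y hy
  rw [lintegral_congr_ae h, lintegral_zero, add_zero] at e
  refine lt_of_le_of_lt le_self_add (e.trans_lt ?_)
  exact ENNReal.add_lt_top.2 ⟨lt_top_of_mem_domInt hc, ENNReal.ofReal_lt_top⟩

/-- Just outside the domain g is infinite, so a finite endpoint value is always below the average.
-/
lemma mem_strictConvexityPoints_of_forall_left (hg : IsCoerciveClosedConvex g) {a : ℝ}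
    (ha : g a < ∞) (h : ∀ y ∈ closure (domInt g), a ≤ y) : a ∈ strictConvexityPoints g := by
  refine eventually_nhdsWithin_of_forall fun δ hδ => ?_
  have hδ' : 0 < δ := hδ
  have : g (a - δ) = ∞ := hg.eq_top_of_notMem_closure fun hmem => by linarith [h _ hmem]
  rw [this, add_top, ENNReal.top_div_of_ne_top (by norm_num)]
  exact ha

lemma mem_strictConvexityPoints_of_forall_right (hg : IsCoerciveClosedConvex g) {b : ℝ}
    (hb : g b < ∞) (h : ∀ y ∈ closure (domInt g), y ≤ b) : b ∈ strictConvexityPoints g := by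
  refine eventually_nhdsWithin_of_forall fun δ hδ => ?_
  have hδ' : 0 < δ := hδ
  have : g (b + δ) = ∞ := hg.eq_top_of_notMem_closure fun hmem => by linarith [h _ hmem]
  rw [this, top_add, ENNReal.top_div_of_ne_top (by norm_num)]
  exact hb

/-- An endpoint where g is finite is itself a strict convexity point, so Q inherits the vanishing
moment of P. At an endpoint where g is infinite, μ must charge every neighbourhood inside the
domain; this gives contact points converging to the endpoint, and the 1-Lipschitz bound on moments
passes to the limit. -/
lemma ae_mem_closure_domInt_of_moments_eq (hP : Integrable (fun x : ℝ => x) P)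
    (hQ : Integrable (fun x : ℝ => x) Q) (hm : ∫ y, y ∂P = ∫ y, y ∂Q)
    (hg : IsCoerciveClosedConvex g) (hPI : ∀ᵐ y ∂P, y ∈ closure (domInt g))
    (hS : ∀ x ∈ strictConvexityPoints g, lowerMoment P x = lowerMoment Q x) :
    ∀ᵐ y ∂Q, y ∈ closure (domInt g) := by
  obtain ⟨μ, _, hμ⟩ := hg.exists_isCurvature
  have hae := hμ.ae_mem_strictConvexityPoints
  have hne : (closure (domInt g)).Nonempty := hg.interior_dom_nonempty.closure
  refine ae_mem_of_moments_eq_zero isClosed_closure hg.convex_domInt.closure.ordConnected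
    (fun z hz => ?_) fun z hz => ?_
  · have hbdd : BddBelow (closure (domInt g)) := ⟨z, fun y hy => (hz y hy).le⟩
    set a := sInf (closure (domInt g)) with ha
    have haC : a ∈ closure (domInt g) := isClosed_closure.csInf_mem hne hbdd
    have hale : ∀ y ∈ closure (domInt g), a ≤ y := fun y hy => csInf_le hbdd hy
    have hPa : lowerMoment P a = 0 := lowerMoment_eq_zero_of_ae hPI hale
    suffices hQa : lowerMoment Q a = 0 from
      nonpos_iff_eq_zero.1 ((lowerMoment_mono Q (hz a haC).le).trans hQa.le)
    by_cases hga : g a < ∞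
    · rw [← hS a (mem_strictConvexityPoints_of_forall_left hg hga hale), hPa]
    · refine nonpos_iff_eq_zero.1 (ENNReal.le_of_forall_pos_le_add fun ε hε _ => ?_)
      obtain ⟨c, hc, hca⟩ := Metric.mem_closure_iff.1 haC ε (by exact_mod_cast hε)
      obtain ⟨t, ht, hte⟩ : ∃ t ∈ Ioc a c, lowerMoment P t = lowerMoment Q t := by
        by_contra! hno
        refine hga (hμ.lt_top_of_ae_kink_eq_zero hc haC ?_)
        filter_upwards [hae] with t htS
        have ht : t ∉ Ioc a c := fun ht => hno t ht (hS t htS)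
        have hac := hale c (subset_closure hc)
        rw [kink]
        split_ifs with hct
        · exact ENNReal.ofReal_of_nonpos (by linarith)
        · refine ENNReal.ofReal_of_nonpos ?_
          by_contra! hta
          exact ht ⟨by linarith, not_lt.1 hct⟩
      calc lowerMoment Q a ≤ lowerMoment Q t := lowerMoment_mono Q ht.1.le
        _ = lowerMoment P t := hte.symm
        _ ≤ lowerMoment P a + ENNReal.ofReal (t - a) := lowerMoment_le_add P t a
        _ ≤ 0 + ε := by
          rw [hPa]
          gcongr
          rw [Real.dist_eq, abs_lt] at hca
          rw [← ENNReal.ofReal_coe_nnreal]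
          exact ENNReal.ofReal_le_ofReal (by linarith [ht.2, hca.1])
  · have hbdd : BddAbove (closure (domInt g)) := ⟨z, fun y hy => (hz y hy).le⟩
    set b := sSup (closure (domInt g)) with hb
    have hbC : b ∈ closure (domInt g) := isClosed_closure.csSup_mem hne hbdd
    have hble : ∀ y ∈ closure (domInt g), y ≤ b := fun y hy => le_csSup hbdd hy
    have hPb : upperMoment P b = 0 := upperMoment_eq_zero_of_ae hPI hble
    suffices hQb : upperMoment Q b = 0 from
      nonpos_iff_eq_zero.1 ((upperMoment_anti Q (hz b hbC).le).trans hQb.le)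
    by_cases hgb : g b < ∞
    · rw [← upperMoment_eq_of_lowerMoment_eq hP hQ hm
        (hS b (mem_strictConvexityPoints_of_forall_right hg hgb hble)), hPb]
    · refine nonpos_iff_eq_zero.1 (ENNReal.le_of_forall_pos_le_add fun ε hε _ => ?_)
      obtain ⟨c, hc, hcb⟩ := Metric.mem_closure_iff.1 hbC ε (by exact_mod_cast hε)
      obtain ⟨t, ht, hte⟩ : ∃ t ∈ Ioo c b, lowerMoment P t = lowerMoment Q t := by
        by_contra! hno
        refine hgb (hμ.lt_top_of_ae_kink_eq_zero hc hbC ?_)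
        filter_upwards [hae] with t htS
        have ht : t ∉ Ioo c b := fun ht => hno t ht (hS t htS)
        have hcb := hble c (subset_closure hc)
        rw [kink]
        split_ifs with hct
        · refine ENNReal.ofReal_of_nonpos ?_
          by_contra! htb
          exact ht ⟨hct, by linarith⟩
        · exact ENNReal.ofReal_of_nonpos (by linarith)
      calc upperMoment Q b ≤ upperMoment Q t := upperMoment_anti Q ht.2.le
        _ = upperMoment P t := (upperMoment_eq_of_lowerMoment_eq hP hQ hm hte).symm
        _ ≤ upperMoment P b + ENNReal.ofReal (b - t) := upperMoment_le_add P t b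
        _ ≤ 0 + ε := by
          rw [hPb]
          gcongr
          rw [Real.dist_eq, abs_lt] at hcb
          rw [← ENNReal.ofReal_coe_nnreal]
          exact ENNReal.ofReal_le_ofReal (by linarith [ht.1, hcb.2])

/-- With the power term carried along, the chain is ∫ g dQ ≤ ∫ g dP, then the tangent inequality at
g to pass from g to h under P, then ∫ h dP ≤ ∫ h dQ. -/
theorem isRenyiProjection_of_moments {s : ℝ} (hs : -1 / 2 < s) (hs0 : s < 0)
    (hQ : Integrable (fun x : ℝ => x) Q) (hg : IsCoerciveClosedConvex g)
    (hf : ∫⁻ x, g x ^ (1 / s) = 1) (hP : Integrable (fun x : ℝ => x) (powerMeasure s g))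
    (hm : ∫ y, y ∂(powerMeasure s g) = ∫ y, y ∂Q)
    (hl : ∀ t, lowerMoment (powerMeasure s g) t ≤ lowerMoment Q t)
    (hS : ∀ x ∈ strictConvexityPoints g, lowerMoment (powerMeasure s g) x = lowerMoment Q x) :
    IsRenyiProjection s Q g := by
  have hr := one_div_lt_neg_two hs hs0
  have := isProbabilityMeasure_powerMeasure hf
  have hPI := ae_powerMeasure_mem_closure hs0 hg
  have hQI := ae_mem_closure_domInt_of_moments_eq hP hQ hm hg hPI hS
  obtain ⟨μ, _, hμ⟩ := hg.exists_isCurvature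
  have hgQ : ∫⁻ y, g y ∂Q ≤ ∫⁻ y, g y ∂(powerMeasure s g) :=
    hμ.lintegral_le hg hQ hP hm.symm hQI hPI
      (hμ.ae_mem_strictConvexityPoints.mono fun t ht => (hS t ht).ge)
  have hgm := hg.measurable
  have hne := hg.ne_zero (r := 1 / s) (by linarith) (by rw [hf]; exact ENNReal.one_ne_top)
  refine ⟨hg, fun h hh => ?_⟩
  have hhm := hh.measurable
  have hhQ : ∫⁻ y, h y ∂(powerMeasure s g) ≤ ∫⁻ y, h y ∂Q :=
    lintegral_le_of_moments_le hP hQ hm hl hh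
  unfold renyiFunctional
  refine (add_le_add_left hgQ _).trans (le_trans ?_ (add_le_add_left hhQ _))
  rw [lintegral_powerMeasure hgm hgm, lintegral_powerMeasure hgm hhm,
    ← lintegral_const_mul _ (hgm.pow_const _), ← lintegral_const_mul _ (hhm.pow_const _),
    ← lintegral_add_left (by fun_prop), ← lintegral_add_left (by fun_prop)]
  exact lintegral_mono fun x => rpow_tangent (by linarith) (hne x) (h x)

end Sufficiency

/-! ### Minimality implies the moment conditions. -/

section Necessity

variable {s : ℝ} {Q : Measure ℝ} [IsProbabilityMeasure Q] {g : ℝ → ℝ≥0∞} {η : ℝ}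

lemma convexOn_mul_add_mul {u v : ℝ → ℝ≥0∞} (hu : ConvexOn ℝ≥0 univ u) (hv : ConvexOn ℝ≥0 univ v)
    (A B : ℝ≥0∞) : ConvexOn ℝ≥0 univ fun x => A * u x + B * v x := by
  refine convexOn_ennreal_of_le fun a b ha hb hab x y => ?_
  calc _ ≤ A * (ENNReal.ofReal a * u x + ENNReal.ofReal b * u y) +
        B * (ENNReal.ofReal a * v x + ENNReal.ofReal b * v y) := by
        gcongr
        · exact hu.ennreal_le ha hb hab x y
        · exact hv.ennreal_le ha hb hab x y
    _ = _ := by ring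

lemma convexOn_toReal_of_lt_top {u : ℝ → ℝ≥0∞} (hu : ConvexOn ℝ≥0 univ u) (hfin : ∀ x, u x < ∞) :
    ConvexOn ℝ univ fun x => (u x).toReal := by
  refine ⟨convex_univ, fun x _ y _ a b ha hb hab => ?_⟩
  have hx := hfin x
  have hy := hfin y
  refine (ENNReal.toReal_mono (by finiteness) (hu.ennreal_le ha hb hab x y)).trans (le_of_eq ?_)
  rw [ENNReal.toReal_add (by finiteness) (by finiteness), ENNReal.toReal_mul, ENNReal.toReal_mul,
    ENNReal.toReal_ofReal ha, ENNReal.toReal_ofReal hb]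
  rfl

variable (hs : -1 / 2 < s) (hs0 : s < 0) (hQ : Integrable (fun x : ℝ => x) Q)
  (hmin : IsRenyiProjection s Q g) (hη : 0 < η)
  (hgrow : ∀ x, ENNReal.ofReal (η * (1 + |x|)) ≤ g x)
include hs hs0 hQ hmin hη hgrow

/-- The first-order condition in a convex direction `p - n`. -/
lemma IsRenyiProjection.first_order_of_convexOn {p n : ℝ → ℝ} {C : ℝ} (hp : Continuous p)
    (hn : Continuous n) (hC : 0 ≤ C) (hp0 : ∀ x, 0 ≤ p x) (hn0 : ∀ x, 0 ≤ n x)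
    (hpC : ∀ x, p x ≤ C * (1 + |x|)) (hnC : ∀ x, n x ≤ C * (1 + |x|))
    (hpn : ConvexOn ℝ univ fun x => p x - n x) :
    ∫⁻ x, ENNReal.ofReal (p x) ∂(powerMeasure s g) + ∫⁻ x, ENNReal.ofReal (n x) ∂Q ≤
      ∫⁻ x, ENNReal.ofReal (n x) ∂(powerMeasure s g) + ∫⁻ x, ENNReal.ofReal (p x) ∂Q := by
  rw [lintegral_powerMeasure hmin.1.measurable (by fun_prop),
    lintegral_powerMeasure hmin.1.measurable (by fun_prop)]
  refine hmin.first_order hs hs0 hQ hη hgrow hp hn hC hpC hnC fun ε h0 h1 _ => ?_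
  refine convexOn_of_add_eq_add hmin.1.convex (fun x => mul_nonneg h0.le (hp0 x))
    (fun x => mul_nonneg h0.le (hn0 x)) ?_ (perturb_add hgrow h0.le hnC h1)
  have : (fun x => ε * p x - ε * n x) = fun x => ε • (p x - n x) := by
    ext x
    rw [smul_eq_mul, mul_sub]
  rw [this]
  exact hpn.smul h0.le

/-- The first-order condition in the convex direction y ↦ (t - y)⁺. -/
lemma IsRenyiProjection.lowerMoment_le (t : ℝ) :
    lowerMoment (powerMeasure s g) t ≤ lowerMoment Q t := by
  have h := hmin.first_order_of_convexOn hs hs0 hQ hη hgrow (p := fun y => max (t - y) 0)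
    (n := fun _ => 0) (C := 1 + |t|) (by fun_prop) (by fun_prop) (by positivity)
    (fun x => le_max_right _ _) (fun x => le_rfl) (fun x => ?_) (fun x => by positivity) ?_
  · simpa [lowerMoment, ENNReal.ofReal_max] using h
  · refine max_le ?_ (by positivity)
    nlinarith [le_abs_self t, neg_abs_le x, abs_nonneg t, abs_nonneg x,
      mul_nonneg (abs_nonneg t) (abs_nonneg x)]
  · simp only [sub_zero]
    refine ConvexOn.sup ⟨convex_univ, fun x _ y _ a b _ _ hab => le_of_eq ?_⟩
      (convexOn_const 0 convex_univ)
    simp only [smul_eq_mul]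
    linear_combination (-t) * hab

/-- Both y and -y are convex directions, so the first-order condition holds with equality. -/
lemma IsRenyiProjection.integral_eq [IsProbabilityMeasure (powerMeasure s g)]
    (hP : Integrable (fun x : ℝ => x) (powerMeasure s g)) :
    ∫ y, y ∂(powerMeasure s g) = ∫ y, y ∂Q := by
  have key : upperMoment (powerMeasure s g) 0 + lowerMoment Q 0 ≤
      lowerMoment (powerMeasure s g) 0 + upperMoment Q 0 := by
    have h := hmin.first_order_of_convexOn hs hs0 hQ hη hgrow (p := fun y => max y 0)
      (n := fun y => max (-y) 0) (C := 1) (by fun_prop) (by fun_prop) zero_le_one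
      (fun x => le_max_right _ _) (fun x => le_max_right _ _)
      (fun x => max_le (by linarith [le_abs_self x]) (by positivity))
      (fun x => max_le (by linarith [neg_abs_le x]) (by positivity)) ?_
    · simpa [lowerMoment, upperMoment, ENNReal.ofReal_max] using h
    · have : (fun x : ℝ => max x 0 - max (-x) 0) = fun x => x :=
        funext max_zero_sub_max_neg_zero_eq_self
      rw [this]
      exact convexOn_id convex_univ
  have key2 : lowerMoment (powerMeasure s g) 0 + upperMoment Q 0 ≤
      upperMoment (powerMeasure s g) 0 + lowerMoment Q 0 := by
    have h := hmin.first_order_of_convexOn hs hs0 hQ hη hgrow (p := fun y => max (-y) 0)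
      (n := fun y => max y 0) (C := 1) (by fun_prop) (by fun_prop) zero_le_one
      (fun x => le_max_right _ _) (fun x => le_max_right _ _)
      (fun x => max_le (by linarith [neg_abs_le x]) (by positivity))
      (fun x => max_le (by linarith [le_abs_self x]) (by positivity)) ?_
    · simpa [lowerMoment, upperMoment, ENNReal.ofReal_max] using h
    · have : (fun x : ℝ => max (-x) 0 - max x 0) = fun x => -x := by
        ext x
        rcases le_total 0 x with h | h
        · rw [max_eq_left h, max_eq_right (by linarith)]; ring
        · rw [max_eq_right h, max_eq_left (by linarith)]; ring
      rw [this]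
      exact (concaveOn_id convex_univ).neg
  have heq := congrArg ENNReal.toReal (le_antisymm key key2)
  rw [ENNReal.toReal_add (upperMoment_lt_top hP 0).ne (lowerMoment_lt_top hQ 0).ne,
    ENNReal.toReal_add (lowerMoment_lt_top hP 0).ne (upperMoment_lt_top hQ 0).ne] at heq
  have h1 := upperMoment_sub_lowerMoment hP 0
  have h2 := upperMoment_sub_lowerMoment hQ 0
  linarith

/-- The first-order condition obtained by removing a fraction of the second derivative measure on
an interval. -/
lemma IsRenyiProjection.setLIntegral_upperMoment_le [IsProbabilityMeasure (powerMeasure s g)]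
    {μ : Measure ℝ} [SFinite μ] (hμ : IsCurvature g μ)
    {a b : ℝ} (ha : a ∈ domInt g) (hb : b ∈ domInt g) :
    ∫⁻ t in Ioc a b, upperMoment Q t ∂μ ≤
      ∫⁻ t in Ioc a b, upperMoment (powerMeasure s g) t ∂μ := by
  -- E is the part of the Taylor remainder of g, based at a, that comes from (a, b], and E' is the
  -- rest. As a lies left of every such t, the kinks in E are (y - t)⁺ and E grows linearly, so -E
  -- is an admissible size of perturbation.
  set E : ℝ → ℝ≥0∞ := fun y => ∫⁻ t in Ioc a b, kink a y t ∂μ with hE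
  set E' : ℝ → ℝ≥0∞ := fun y => ∫⁻ t in (Ioc a b)ᶜ, kink a y t ∂μ with hE'
  have hEconv : ConvexOn ℝ≥0 univ E := convexOn_lintegral_kink a _
  have hμab := hμ.measure_Ioc_lt_top ha hb
  set M := (μ (Ioc a b)).toReal with hM
  have hM0 : 0 ≤ M := ENNReal.toReal_nonneg
  have hEle : ∀ y, E y ≤ ENNReal.ofReal (M * (1 + |a|) * (1 + |y|)) := by
    intro y
    calc E y ≤ ∫⁻ _ in Ioc a b, ENNReal.ofReal ((1 + |a|) * (1 + |y|)) ∂μ := by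
          refine setLIntegral_mono' measurableSet_Ioc fun t ht => ?_
          rw [kink, if_pos ht.1]
          refine ENNReal.ofReal_le_ofReal ?_
          nlinarith [ht.1, le_abs_self y, neg_abs_le a, abs_nonneg a, abs_nonneg y,
            mul_nonneg (abs_nonneg a) (abs_nonneg y)]
      _ = _ := by
          rw [setLIntegral_const, ← ENNReal.ofReal_toReal hμab.ne, ← hM,
            ← ENNReal.ofReal_mul (by positivity)]
          congr 1; ring
  have hEfin : ∀ y, E y < ∞ := fun y => (hEle y).trans_lt ENNReal.ofReal_lt_top
  set w : ℝ → ℝ := fun y => (E y).toReal with hw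
  have hwE : ∀ y, ENNReal.ofReal (w y) = E y := fun y => ENNReal.ofReal_toReal (hEfin y).ne
  have hwcont : Continuous w := by
    rw [← continuousOn_univ]
    exact (convexOn_toReal_of_lt_top hEconv hEfin).continuousOn isOpen_univ
  have hwC : ∀ y, w y ≤ M * (1 + |a|) * (1 + |y|) := fun y =>
    ENNReal.toReal_le_of_le_ofReal (by positivity) (hEle y)
  have hfo := hmin.first_order (p := fun _ => 0) hs hs0 hQ hη hgrow continuous_const hwcont
    (C := M * (1 + |a|)) (by positivity) (fun x => by positivity) hwC ?_
  · have hswap : ∀ (ν : Measure ℝ) [SFinite ν],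
        ∫⁻ y, E y ∂ν = ∫⁻ t in Ioc a b, upperMoment ν t ∂μ := by
      intro ν _
      rw [hE, lintegral_lintegral_swap (measurable_kink a).aemeasurable]
      refine setLIntegral_congr_fun measurableSet_Ioc fun t ht => ?_
      simp only [kink, if_pos ht.1, upperMoment]
    have hEm : Measurable E := by
      rw [← funext hwE]
      exact (ENNReal.continuous_ofReal.comp hwcont).measurable
    rw [← hswap, ← hswap, lintegral_powerMeasure hmin.1.measurable hEm]
    simpa [hwE] using hfo
  · intro ε h0 h1 h2
    obtain ⟨p, hp⟩ := hμ.2 a ha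
    have hadd := perturb_add (p := fun _ => 0) hgrow h0.le hwC h1
    set h := perturb g (fun _ => 0) w ε with hh
    have hadd' : ∀ y, h y + ENNReal.ofReal ε * E y = g y := fun y => by
      have := hadd y
      rwa [mul_zero, ENNReal.ofReal_zero, add_zero, ENNReal.ofReal_mul h0.le, hwE] at this
    -- On the closure of the domain, g - εE = (1 - ε) g + ε (g(a) + p(y - a) + E'), a sum of convex
    -- functions; the affine part is split into nonnegative pieces. Off the closure both sides are
    -- infinite.
    refine convexOn_of_add_eq_add
      (g := fun y => ENNReal.ofReal (1 - ε) * g y + ENNReal.ofReal ε * E' y)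
      (p := fun y => ε * (max (p * (y - a)) 0 + (g a).toReal))
      (n := fun y => ε * max (-(p * (y - a))) 0)
      (convexOn_mul_add_mul hmin.1.convex (convexOn_lintegral_kink a _) _ _)
      (fun y => by positivity) (fun y => by positivity) ?_ fun y => ?_
    · have : (fun y => ε * (max (p * (y - a)) 0 + (g a).toReal) - ε * max (-(p * (y - a))) 0) =
          fun y => ε * (p * (y - a) + (g a).toReal) := by
        ext y
        have := max_zero_sub_max_neg_zero_eq_self (p * (y - a))
        linear_combination ε * this
      rw [this]
      refine ⟨convex_univ, fun x _ y _ α β _ _ hαβ => le_of_eq ?_⟩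
      simp only [smul_eq_mul]
      linear_combination (ε * (p * a - (g a).toReal)) * hαβ
    · by_cases hy : y ∈ closure (domInt g)
      · have hrep := hp y hy
        rw [← lintegral_add_compl _ (measurableSet_Ioc (a := a) (b := b))] at hrep
        change _ = _ + (E y + E' y) at hrep
        rw [ENNReal.ofReal_mul h0.le, ENNReal.ofReal_mul h0.le,
          ENNReal.ofReal_add (le_max_right _ _) ENNReal.toReal_nonneg,
          ENNReal.ofReal_toReal (lt_top_of_mem_domInt ha).ne, ENNReal.ofReal_max,
          ENNReal.ofReal_max, ENNReal.ofReal_zero, max_eq_left zero_le, max_eq_left zero_le]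
        have h12 : ENNReal.ofReal (1 - ε) + ENNReal.ofReal ε = 1 := by
          rw [← ENNReal.ofReal_add (by linarith) h0.le, sub_add_cancel, ENNReal.ofReal_one]
        set e := ENNReal.ofReal ε
        set e' := ENNReal.ofReal (1 - ε)
        have hfin : e * E y ≠ ∞ := ENNReal.mul_ne_top ENNReal.ofReal_ne_top (hEfin y).ne
        refine (ENNReal.add_left_inj hfin).1 ?_
        calc h y + e * ENNReal.ofReal (-(p * (y - a))) + e * E y
            = (e' + e) * (h y + e * E y) + e * ENNReal.ofReal (-(p * (y - a))) := by
              rw [h12]; ring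
          _ = e' * g y + e * (g y + ENNReal.ofReal (-(p * (y - a)))) := by rw [hadd']; ring
          _ = _ := by rw [hrep]; ring
      · have htop := hmin.1.eq_top_of_notMem_closure hy
        have hhtop : h y = ∞ := by
          have := hadd' y
          rw [htop, ENNReal.add_eq_top] at this
          exact this.resolve_right (ENNReal.mul_ne_top ENNReal.ofReal_ne_top (hEfin y).ne)
        rw [hhtop, htop, ENNReal.mul_top (ENNReal.ofReal_pos.2 (by linarith)).ne', top_add, top_add,
          top_add]

/-- If the moments of Q strictly exceeded those of P throughout a small interval around an interior
x, integrating over that interval, which μ charges, would contradict `setLIntegral_upperMoment_le`.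
So contact occurs arbitrarily near x, and the Lipschitz bounds carry it to x. -/
lemma IsRenyiProjection.lowerMoment_eq [IsProbabilityMeasure (powerMeasure s g)]
    (hP : Integrable (fun x : ℝ => x) (powerMeasure s g)) {x : ℝ}
    (hx : x ∈ strictConvexityPoints g) : lowerMoment (powerMeasure s g) x = lowerMoment Q x := by
  have hm := hmin.integral_eq hs hs0 hQ hη hgrow hP
  have hl := hmin.lowerMoment_le hs hs0 hQ hη hgrow
  have hg := hmin.1
  have hPI := ae_powerMeasure_mem_closure hs0 hg
  have hQI : ∀ᵐ y ∂Q, y ∈ closure (domInt g) := by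
    filter_upwards [ae_lt_top hg.measurable (hmin.lintegral_lt_top hs hs0 hQ).ne] with y hy
    by_contra h
    exact hy.ne (hg.eq_top_of_notMem_closure h)
  by_cases hxI : x ∈ domInt g
  · obtain ⟨μ, _, hμ⟩ := hg.exists_isCurvature
    have key : ∀ᶠ δ in 𝓝[>] (0 : ℝ), lowerMoment Q x ≤
        lowerMoment (powerMeasure s g) x + ENNReal.ofReal (2 * δ) := by
      filter_upwards [IsCurvature.eventually_add_sub_mem hxI, self_mem_nhdsWithin,
        hμ.eventually_measure_Ioo_ne_zero hxI hx] with δ hmem hδ hne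
      have hδ' : 0 < δ := hδ
      obtain ⟨t, ht, hte⟩ : ∃ t ∈ Ioc (x - δ) (x + δ),
          lowerMoment Q t ≤ lowerMoment (powerMeasure s g) t := by
        by_contra! hno
        have hlt : ∀ t ∈ Ioc (x - δ) (x + δ),
            upperMoment (powerMeasure s g) t < upperMoment Q t := fun t ht => by
          rw [← not_le, upperMoment_le_iff hQ hP hm.symm]
          exact not_le.2 (hno t ht)
        refine absurd (hmin.setLIntegral_upperMoment_le hs hs0 hQ hη hgrow hμ hmem.2 hmem.1)
          (not_le.2 (setLIntegral_strict_mono measurableSet_Ioc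
            (fun h0 => hne (measure_mono_null Ioo_subset_Ioc_self h0))
            (upperMoment_anti Q).measurable ?_ (ae_of_all _ hlt)))
        refine ne_of_lt (lt_of_le_of_lt (setLIntegral_mono' measurableSet_Ioc fun t ht =>
          upperMoment_anti _ ht.1.le) ?_)
        rw [setLIntegral_const]
        exact ENNReal.mul_lt_top (upperMoment_lt_top hP _)
          (hμ.measure_Ioc_lt_top hmem.2 hmem.1)
      calc lowerMoment Q x ≤ lowerMoment Q t + ENNReal.ofReal (x - t) := lowerMoment_le_add Q x t
        _ ≤ lowerMoment (powerMeasure s g) t + ENNReal.ofReal δ :=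
          add_le_add hte (ENNReal.ofReal_le_ofReal (by linarith [ht.1]))
        _ ≤ lowerMoment (powerMeasure s g) x + ENNReal.ofReal (t - x) + ENNReal.ofReal δ := by
          gcongr
          exact lowerMoment_le_add _ t x
        _ ≤ lowerMoment (powerMeasure s g) x + ENNReal.ofReal δ + ENNReal.ofReal δ := by
          gcongr
          linarith [ht.2]
        _ = _ := by
          rw [add_assoc, ← ENNReal.ofReal_add hδ'.le hδ'.le]
          congr 2; ring
    have hlim : Tendsto (fun δ : ℝ => lowerMoment (powerMeasure s g) x + ENNReal.ofReal (2 * δ))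
        (𝓝[>] 0) (𝓝 (lowerMoment (powerMeasure s g) x)) := by
      have hc : Continuous fun δ : ℝ =>
          lowerMoment (powerMeasure s g) x + ENNReal.ofReal (2 * δ) :=
        continuous_const.add (ENNReal.continuous_ofReal.comp (by fun_prop))
      have := hc.tendsto 0
      simp only [mul_zero, ENNReal.ofReal_zero, add_zero] at this
      exact this.mono_left nhdsWithin_le_nhds
    exact le_antisymm (hl x) (ge_of_tendsto hlim key)
  -- Outside the interior of the domain, x lies to one side of both measures: on the left both lower
  -- moments vanish, on the right both upper moments do, and equal means convert the latter.
  · by_cases hleft : ∀ y ∈ domInt g, x ≤ y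
    · have hcl : ∀ y ∈ closure (domInt g), x ≤ y := fun y hy =>
        closure_minimal (show domInt g ⊆ Ici x from hleft) isClosed_Ici hy
      rw [lowerMoment_eq_zero_of_ae hPI hcl, lowerMoment_eq_zero_of_ae hQI hcl]
    · have hright : ∀ y ∈ domInt g, y ≤ x := by
        push Not at hleft
        obtain ⟨v, hv, hvx⟩ := hleft
        intro y hy
        by_contra! hxy
        exact hxI (hg.convex_domInt.ordConnected.out hv hy ⟨hvx.le, hxy.le⟩)
      have hcl : ∀ y ∈ closure (domInt g), y ≤ x := fun y hy =>
        closure_minimal (show domInt g ⊆ Iic x from hright) isClosed_Iic hy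
      refine le_antisymm (hl x) ((upperMoment_le_iff hQ hP hm.symm x).1 ?_)
      rw [upperMoment_eq_zero_of_ae hPI hcl, upperMoment_eq_zero_of_ae hQI hcl]

end Necessity

/-! ### The characterization of the minimizer. -/

theorem mainTheorem8 (s : ℝ) (hs : -1 / 2 < s) (hs0 : s < 0)
    (Q : Measure ℝ) [IsProbabilityMeasure Q]
    (hQ0 : (interior (csupp Q)).Nonempty)
    (hQ1 : Integrable (fun x : ℝ => x) Q)
    (g : ℝ → ℝ≥0∞) (hg : IsCoerciveClosedConvex g)
    (hf : ∫⁻ x, g x ^ (1 / s) = 1) :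
    Integrable (fun t => cdf (powerMeasure s g) t - cdf Q t) ∧
      (IsRenyiProjection s Q g ↔
        (∫ t, (cdf (powerMeasure s g) t - cdf Q t)) = 0 ∧
        (∀ x : ℝ, (∫ t in Iic x, (cdf (powerMeasure s g) t - cdf Q t)) ≤ 0) ∧
        (∀ x ∈ strictConvexityPoints g,
          (∫ t in Iic x, (cdf (powerMeasure s g) t - cdf Q t)) = 0)) := by
  have hprob := isProbabilityMeasure_powerMeasure hf
  have hr := one_div_lt_neg_two hs hs0
  obtain ⟨η, hη, hgrow⟩ := hg.exists_linear_growth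
    (hg.ne_zero (r := 1 / s) (by linarith) (by rw [hf]; exact ENNReal.one_ne_top))
  have hP := integrable_powerMeasure hs hs0 hg.measurable hη hgrow
  obtain ⟨hint, hmean⟩ := integrable_cdf_sub_cdf hP hQ1
  have hle : ∀ x, (lowerMoment (powerMeasure s g) x).toReal - (lowerMoment Q x).toReal ≤ 0 ↔
      lowerMoment (powerMeasure s g) x ≤ lowerMoment Q x := fun x => by
    rw [sub_nonpos, ENNReal.toReal_le_toReal (lowerMoment_lt_top hP x).ne
      (lowerMoment_lt_top hQ1 x).ne]
  have heq : ∀ x, (lowerMoment (powerMeasure s g) x).toReal - (lowerMoment Q x).toReal = 0 ↔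
      lowerMoment (powerMeasure s g) x = lowerMoment Q x := fun x => by
    rw [sub_eq_zero, ENNReal.toReal_eq_toReal_iff' (lowerMoment_lt_top hP x).ne
      (lowerMoment_lt_top hQ1 x).ne]
  refine ⟨hint, ?_⟩
  simp only [hmean, setIntegral_Iic_cdf_sub_cdf hP hQ1, hle, heq]
  constructor
  · intro hmin
    exact ⟨sub_eq_zero.2 (hmin.integral_eq hs hs0 hQ1 hη hgrow hP).symm,
      hmin.lowerMoment_le hs hs0 hQ1 hη hgrow,
      fun x hx => hmin.lowerMoment_eq hs hs0 hQ1 hη hgrow hP hx⟩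
  · rintro ⟨hm, hl, hS⟩
    exact isRenyiProjection_of_moments hs hs0 hQ1 hg hf hP (sub_eq_zero.1 hm).symm hl hS
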